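/- Let $A$ and $B$ be $C^*$-algebras, let $V$ be a full (right) Hilbert $A$-module and $W$ a full (right) Hilbert $B$-module (full: the linear span of the inner products is dense in the algebra). A representation of $V$ on Hilbert spaces $H,K$ is a map $\Phi:V\to B(H,K)$ together with a representation ($*$-homomorphism) $\varphi:A\to B(H)$ such that $\Phi(v)^*\Phi(v')=\varphi(\langle v,v'\rangle)$ for all $v,v'\in V$; it is non-degenerate if $\overline{\operatorname{span}}\,\Phi(V)H=K$ and $\overline{\operatorname{span}}\,\Phi(V)^*K=H$. Two representations $\Phi:V\to B(H,K)$ and $\Phi':V\to B(H',K')$ are unitarily equivalent if there are unitaries $U_1:H\to H'$, $U_2:K\to K'$ with $U_2\Phi(v)=\Phi'(v)U_1$ for all $v\in V$. The non-degenerate representations of $V$ form a category: a morphism from $\Phi$ to $\Phi'$ is a pair of bounded operators $T:H\to H'$, $S:K\to K'$ with $S\Phi(v)=\Phi'(v)T$ for all $v\in V$. A morphism is called unitary if $T$ and $S$ are unitary. An $A$–$B$-imprimitivity bimodule is an $A$–$B$-bimodule $X$ that is a full left Hilbert $A$-module and a full right Hilbert $B$-module, such that $\langle ax,y\rangle_B=\langle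 x,a^*y\rangle_B$, ${}_A\langle xb,y\rangle={}_A\langle x,yb^*\rangle$ and ${}_A\langle x,y\rangle z=x\langle y,z\rangle_B$ for all $x,y,z\in X$, $a\in A$, $b\in B$. Its dual $\widetilde X$ is the conjugate vector space of $X$, with the conjugate linear bijection $\flat:X\to\widetilde X$, made into a $B$–$A$-imprimitivity bimodule by $b\,\flat(x)=\flat(xb^*)$, $\flat(x)a=\flat(a^*x)$, ${}_B\langle \flat(x),\flat(y)\rangle=\langle x,y\rangle_B$, $\langle \flat(x),\flat(y)\rangle_A={}_A\langle x,y\rangle$. For a non-degenerate representation $\Phi:W\to B(H,K)$ of $W$, with associated representation $\varphi$ of $B$, let $X\otimes_BH$ be the Hausdorff completion of $X\otimes H$ for $\langle x\otimes h,y\otimes k\rangle=\langle h,\varphi(\langle x,y\rangle_B)k\rangle$, on which $A$ acts by $a(x\otimes h)=ax\otimes h$, and let $V\otimes_A X\otimes_BH$ be the Hausdorff completion of $V\otimes(X\otimes_BH)$ for $\langle v\otimes\xi,w\otimes\eta\rangle=\langle\xi,\langle v,w\rangle\eta\rangle$. The induced representation $\mathrm{Ind}_X\Phi:V\to B(X\otimes_BH,\;V\otimes_AX\otimes_BH)$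 is the non-degenerate representation $\mathrm{Ind}_X\Phi(v)(x\otimes h)=v\otimes x\otimes h$ of $V$. On a morphism $(T,S)$ put $\mathrm{Ind}_X(T,S)=(1\otimes T,\,1\otimes1\otimes T)$; this makes $\mathrm{Ind}_X$ a functor. The functor $\mathrm{Ind}_{\widetilde X}$ from the non-degenerate representations of $V$ to those of $W$ is defined in the same way. **Theorem.** (1) For every $A$–$B$-imprimitivity bimodule $X$ and all non-degenerate representations $\Phi$ of $W$ and $\Psi$ of $V$, $\mathrm{Ind}_{\widetilde X}(\mathrm{Ind}_X\Phi)$ is naturally unitarily equivalent to $\Phi$, and $\mathrm{Ind}_X(\mathrm{Ind}_{\widetilde X}\Psi)$ is naturally unitarily equivalent to $\Psi$; that is, there are natural isomorphisms of functors $\mathrm{Ind}_{\widetilde X}\circ\mathrm{Ind}_X\cong\mathrm{id}$ and $\mathrm{Ind}_X\circ\mathrm{Ind}_{\widetilde X}\cong\mathrm{id}$ all of whose components are unitary. (2) Consequently, if $V$ and $W$ are Morita equivalent in the sense of Joita and Moslehian, i.e. if there is a $K(V)$–$K(W)$-imprimitivity bimodule, where $K(\cdot)$ denotes the $C^*$-algebra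 of compact operators of a Hilbert module, then the categories of non-degenerate representations of $V$ and of $W$ are equivalent, by an equivalence whose functors in both directions send unitary morphisms to unitary morphisms and whose unit and counit are unitary. -/

import Mathlib

universe u

open scoped TensorProduct InnerProductSpace

/-- A (right) Hilbert `C⋆`-module over the `C⋆`-algebra `A`: a complex Banach space `V` with a
right action of `A` and an `A`-valued inner product, `A`-linear in the second and conjugate linear
in the first variable, that induces the norm.  (Mathlib's `CStarModule` is about left actions.) -/
class HilbertModule (A V : Type*) [NonUnitalCStarAlgebra A] [PartialOrder A]
    [NormedAddCommGroup V] [NormedSpace ℂ V] where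
  complete : CompleteSpace V
  /-- the right action `(v, a) ↦ v a` -/
  rsmul : V → A → V
  add_rsmul : ∀ v w a, rsmul (v + w) a = rsmul v a + rsmul w a
  rsmul_add : ∀ v a b, rsmul v (a + b) = rsmul v a + rsmul v b
  rsmul_mul : ∀ v a b, rsmul v (a * b) = rsmul (rsmul v a) b
  smul_rsmul : ∀ (c : ℂ) v a, rsmul (c • v) a = c • rsmul v a
  rsmul_smul : ∀ (c : ℂ) v a, rsmul v (c • a) = c • rsmul v a
  /-- the `A`-valued inner product `⟨v, w⟩_A` -/
  ip : V → V → A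
  ip_add_right : ∀ v w w', ip v (w + w') = ip v w + ip v w'
  ip_smul_right : ∀ (c : ℂ) v w, ip v (c • w) = c • ip v w
  ip_rsmul_right : ∀ v w a, ip v (rsmul w a) = ip v w * a
  star_ip : ∀ v w, star (ip v w) = ip w v
  ip_self_nonneg : ∀ v, 0 ≤ ip v v
  ip_self_eq_zero : ∀ v, ip v v = 0 → v = 0
  norm_sq_eq : ∀ v, ‖v‖ ^ 2 = ‖ip v v‖

/-- A Hilbert module is full if the linear span of its inner products is dense. -/
def IsFull (A V : Type*) [NonUnitalCStarAlgebra A] [PartialOrder A]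
    [NormedAddCommGroup V] [NormedSpace ℂ V] [HilbertModule A V] : Prop :=
  Dense (Submodule.span ℂ {a : A | ∃ v w : V, HilbertModule.ip v w = a} : Set A)

namespace HilbertModule

section Basic

variable {A V : Type*} [NonUnitalCStarAlgebra A] [PartialOrder A]
  [NormedAddCommGroup V] [NormedSpace ℂ V] [HilbertModule A V]

theorem ip_add_left (v v' w : V) : (ip (v + v') w : A) = (ip v w : A) + (ip v' w : A) := by
  rw [← star_ip w, ip_add_right, star_add, star_ip, star_ip]

theorem ip_smul_left (c : ℂ) (v w : V) : (ip (c • v) w : A) = star c • (ip v w : A) := by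
  rw [← star_ip w, ip_smul_right, star_smul, star_ip]

theorem ip_rsmul_left (v w : V) (a : A) : (ip (rsmul v a) w : A) = star a * (ip v w : A) := by
  rw [← star_ip w, ip_rsmul_right, star_mul, star_ip]

variable (A) in
/-- The inner product as a sesquilinear map. -/
def ipₛₗ : V →ₗ⋆[ℂ] V →ₗ[ℂ] A :=
  LinearMap.mk₂'ₛₗ (starRingEnd ℂ) (RingHom.id ℂ) (fun v w => (ip v w : A))
    ip_add_left ip_smul_left ip_add_right ip_smul_right

variable (V) in
/-- The right action as a bilinear map. -/
def rsmulₗ : V →ₗ[ℂ] A →ₗ[ℂ] V :=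
  LinearMap.mk₂ ℂ (fun v a => rsmul v a) (fun v w a => add_rsmul v w a)
    (fun c v a => smul_rsmul c v a) (fun v a b => rsmul_add v a b)
    (fun c v a => rsmul_smul c v a)

theorem ip_sub_right (v w w' : V) :
    (ip v (w - w') : A) = (ip v w : A) - (ip v w' : A) :=
  map_sub (ipₛₗ A v) w w'

theorem ip_sub_left (v v' w : V) : (ip (v - v') w : A) = (ip v w : A) - (ip v' w : A) :=
  map_sub ((ipₛₗ A).flip w) v v'

theorem ip_zero_left (w : V) : (ip 0 w : A) = 0 := map_zero ((ipₛₗ A).flip w)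

theorem ip_zero_right (w : V) : (ip w 0 : A) = 0 := map_zero (ipₛₗ A w)

theorem ip_sum_right {ι : Type*} (s : Finset ι) (v : V) (w : ι → V) :
    (ip v (∑ i ∈ s, w i) : A) = ∑ i ∈ s, (ip v (w i) : A) := map_sum (ipₛₗ A v) w s

theorem ip_sum_left {ι : Type*} (s : Finset ι) (w : V) (v : ι → V) :
    (ip (∑ i ∈ s, v i) w : A) = ∑ i ∈ s, (ip (v i) w : A) :=
  map_sum ((ipₛₗ A).flip w) v s

variable (A) in
theorem ext_ip {v w : V} (h : ∀ z : V, (ip z v : A) = (ip z w : A)) : v = w := by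
  rw [← sub_eq_zero]
  refine ip_self_eq_zero (A := A) _ ?_
  rw [ip_sub_right, h, sub_self]

theorem norm_rsmul_le (v : V) (a : A) : ‖rsmul v a‖ ≤ ‖v‖ * ‖a‖ := by
  refine le_of_sq_le_sq ?_ (by positivity) |>.trans le_rfl
  rw [norm_sq_eq (A := A), ip_rsmul_right, ip_rsmul_left, mul_pow, norm_sq_eq (A := A)]
  refine norm_mul₃_le.trans_eq ?_
  rw [norm_star]
  ring

variable [StarOrderedRing A]

theorem norm_ip_le (v w : V) : ‖(ip v w : A)‖ ≤ ‖v‖ * ‖w‖ := by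
  rcases eq_or_ne v 0 with rfl | hv
  · simp [ip_zero_left]
  have hv' : 0 < ‖v‖ ^ 2 := by positivity
  set a : A := (ip v w : A) with ha
  have h0 : (0 : A) ≤ (ip (rsmul v a - ((‖v‖ ^ 2 : ℝ) : ℂ) • w)
      (rsmul v a - ((‖v‖ ^ 2 : ℝ) : ℂ) • w) : A) :=
    ip_self_nonneg _
  have h1 : (ip (rsmul v a - ((‖v‖ ^ 2 : ℝ) : ℂ) • w)
      (rsmul v a - ((‖v‖ ^ 2 : ℝ) : ℂ) • w) : A)
      = star a * (ip v v : A) * a - (‖v‖ ^ 2) • (star a * a) - (‖v‖ ^ 2) • (star a * a)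
        + (‖v‖ ^ 2) • (‖v‖ ^ 2) • (ip w w : A) := by
    have hs : (ip w v : A) = star a := by rw [ha, star_ip]
    simp only [ip_sub_right, ip_sub_left, ip_rsmul_left, ip_rsmul_right, ip_smul_left,
      ip_smul_right, hs, ← ha, Complex.star_def, Complex.conj_ofReal,
      smul_mul_assoc, sub_mul, smul_sub]
    simp only [Complex.coe_smul]
    abel
  have h2 : star a * (ip v v : A) * a ≤ (‖v‖ ^ 2) • (star a * a) := by
    rw [norm_sq_eq (A := A)]
    exact CStarAlgebra.star_left_conjugate_le_norm_smul (hb := star_ip v v)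
  have h3 : (‖v‖ ^ 2) • (star a * a) ≤ (‖v‖ ^ 2) • (‖v‖ ^ 2) • (ip w w : A) := by
    rw [h1] at h0
    have := add_le_add h0 h2
    rw [← sub_nonneg] at this ⊢
    refine this.trans_eq ?_
    abel
  have h4 : star a * a ≤ (‖v‖ ^ 2) • (ip w w : A) := by
    rwa [smul_le_smul_iff_of_pos_left hv'] at h3
  have h5 := CStarAlgebra.norm_le_norm_of_nonneg_of_le (star_mul_self_nonneg a) h4
  rw [CStarRing.norm_star_mul_self, norm_smul, ← norm_sq_eq (A := A), Real.norm_of_nonneg hv'.le]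
    at h5
  refine le_of_sq_le_sq ?_ (by positivity)
  nlinarith

variable (A V) in
/-- The inner product as a bounded sesquilinear map. -/
noncomputable def ipSL : V →L⋆[ℂ] V →L[ℂ] A :=
  LinearMap.mkContinuous₂ (ipₛₗ A) 1 fun v w => by
    simpa [ipₛₗ] using norm_ip_le (A := A) v w

theorem continuous_ip {T : Type*} [TopologicalSpace T] {f g : T → V} (hf : Continuous f)
    (hg : Continuous g) : Continuous fun t => (ip (f t) (g t) : A) := by
  change Continuous fun t => ipSL A V (f t) (g t)
  fun_prop

variable (V) in
/-- The right action as a bounded bilinear map. -/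
noncomputable def rsmulL : V →L[ℂ] A →L[ℂ] V :=
  LinearMap.mkContinuous₂ (rsmulₗ V) 1 fun v a => by
    simpa [rsmulₗ] using norm_rsmul_le v a

end Basic

section Operators

variable (A V : Type*) [NonUnitalCStarAlgebra A] [PartialOrder A] [StarOrderedRing A]
  [NormedAddCommGroup V] [NormedSpace ℂ V] [HilbertModule A V]

/-- The algebra `L(V)` of adjointable operators on the Hilbert `A`-module `V`. -/
def adjointable : Subalgebra ℂ (V →L[ℂ] V) where
  carrier := {T | ∃ S : V →L[ℂ] V, ∀ v w : V, (ip (T v) w : A) = ip v (S w)}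
  mul_mem' := by
    rintro T T' ⟨S, hS⟩ ⟨S', hS'⟩
    exact ⟨S' * S, fun v w => by simp [hS, hS']⟩
  add_mem' := by
    rintro T T' ⟨S, hS⟩ ⟨S', hS'⟩
    exact ⟨S + S', fun v w => by simp [hS, hS', ip_add_left, ip_add_right]⟩
  algebraMap_mem' c := ⟨star c • 1, fun v w => by
    simp [Algebra.algebraMap_eq_smul_one, ip_smul_left, ip_smul_right]⟩

/-- `L(V)` as a type. -/
abbrev Adjointable : Type _ := adjointable A V

variable {A V}

theorem adjointable_ext {S S' : V →L[ℂ] V} (h : ∀ v w : V, (ip v (S w) : A) = ip v (S' w)) :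
    S = S' :=
  ContinuousLinearMap.ext fun w => ext_ip A fun v => h v w

noncomputable instance : Star (Adjointable A V) where
  star T := ⟨T.2.choose, T, fun v w => by
    rw [← star_ip, ← T.2.choose_spec, star_ip]⟩

theorem ip_apply_left (T : Adjointable A V) (v w : V) :
    (ip (T.1 v) w : A) = ip v ((star T).1 w) := T.2.choose_spec v w

theorem ip_apply_right (T : Adjointable A V) (v w : V) :
    (ip v (T.1 w) : A) = ip ((star T).1 v) w := by
  rw [← star_ip, ip_apply_left, star_ip]

theorem star_eq_of_forall {T S : Adjointable A V}
    (h : ∀ v w : V, (ip (T.1 v) w : A) = ip v (S.1 w)) : star T = S :=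
  Subtype.ext <| adjointable_ext (A := A) fun v w => by rw [← ip_apply_left, h]

noncomputable instance : StarRing (Adjointable A V) where
  star_involutive T := star_eq_of_forall fun v w => (ip_apply_right T v w).symm
  star_mul T S := star_eq_of_forall fun v w => by
    change (ip (T.1 (S.1 v)) w : A) = ip v ((star S).1 ((star T).1 w))
    rw [ip_apply_left, ip_apply_left]
  star_add T S := star_eq_of_forall fun v w => by
    change (ip (T.1 v + S.1 v) w : A) = ip v ((star T).1 w + (star S).1 w)
    rw [ip_add_left, ip_add_right, ip_apply_left, ip_apply_left]

noncomputable instance : StarModule ℂ (Adjointable A V) where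
  star_smul c T := star_eq_of_forall fun v w => by
    change (ip (c • T.1 v) w : A) = ip v (star c • (star T).1 w)
    rw [ip_smul_left, ip_smul_right, ip_apply_left]

noncomputable instance : CStarRing (Adjointable A V) where
  norm_mul_self_le T := by
    suffices h : ‖T.1‖ ≤ √‖star T * T‖ by
      calc ‖T‖ * ‖T‖ ≤ √‖star T * T‖ * √‖star T * T‖ := by
            change ‖T.1‖ * ‖T.1‖ ≤ _
            gcongr
        _ = _ := Real.mul_self_sqrt (norm_nonneg _)
    refine ContinuousLinearMap.opNorm_le_bound _ (by positivity) fun v => ?_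
    refine le_of_sq_le_sq ?_ (by positivity)
    rw [mul_pow, Real.sq_sqrt (norm_nonneg (star T * T)), norm_sq_eq (A := A), ip_apply_left]
    calc ‖(ip v ((star T * T).1 v) : A)‖ ≤ ‖v‖ * ‖(star T * T).1 v‖ := norm_ip_le _ _
      _ ≤ ‖v‖ * (‖star T * T‖ * ‖v‖) := by
          gcongr
          exact (star T * T).1.le_opNorm v
      _ = _ := by ring

theorem norm_star_adjointable (T : Adjointable A V) : ‖star T‖ = ‖T‖ := norm_star T

instance : CompleteSpace (Adjointable A V) := by
  have : CompleteSpace V := complete A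
  refine IsComplete.completeSpace_coe (s := (adjointable A V : Set (V →L[ℂ] V))) ?_
  refine IsClosed.isComplete ?_
  refine isClosed_of_closure_subset fun T hT => ?_
  obtain ⟨u, hu, hlim⟩ := mem_closure_iff_seq_limit.mp hT
  let t : ℕ → Adjointable A V := fun n => ⟨u n, hu n⟩
  have hc : CauchySeq fun n => (star (t n)).1 := by
    rw [Metric.cauchySeq_iff']
    intro ε hε
    obtain ⟨N, hN⟩ := Metric.cauchySeq_iff'.mp hlim.cauchySeq ε hε
    refine ⟨N, fun n hn => ?_⟩
    have := hN n hn
    rw [dist_eq_norm] at this ⊢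
    have h := norm_star (t n - t N)
    rw [star_sub] at h
    exact h.trans_lt this
  obtain ⟨S, hS⟩ := cauchySeq_tendsto_of_complete hc
  refine ⟨S, fun v w => ?_⟩
  have h1 : Filter.Tendsto (fun n => ipSL A V ((u n) v) w) Filter.atTop
      (nhds (ipSL A V (T v) w)) := by
    have : Continuous fun R : V →L[ℂ] V => ipSL A V (R v) w := by fun_prop
    exact (this.tendsto T).comp hlim
  have h2 : Filter.Tendsto (fun n => ipSL A V v ((star (t n)).1 w)) Filter.atTop
      (nhds (ipSL A V v (S w))) := by
    have : Continuous fun R : V →L[ℂ] V => ipSL A V v (R w) := by fun_prop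
    exact (this.tendsto S).comp hS
  refine tendsto_nhds_unique h1 (h2.congr fun n => ?_)
  exact (ip_apply_left (t n) v w).symm

/-- `L(V)` is a unital `C⋆`-algebra. -/
noncomputable instance : CStarAlgebra (Adjointable A V) where

/-- The rank-one operator `θ_{v,w} z = v ⟨w, z⟩`. -/
noncomputable def rankOne (v w : V) : Adjointable A V :=
  ⟨(rsmulL V (A := A) v).comp (ipSL A V w), (rsmulL V (A := A) w).comp (ipSL A V v), fun z z' => by
    change (ip (rsmul v (ip w z : A)) z' : A) = ip z (rsmul w (ip v z' : A))
    rw [ip_rsmul_left, ip_rsmul_right, star_ip]⟩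

theorem rankOne_apply (v w z : V) : (rankOne v w : Adjointable A V).1 z = rsmul v (ip w z : A) :=
  rfl

theorem star_rankOne (v w : V) : star (rankOne v w : Adjointable A V) = rankOne w v :=
  star_eq_of_forall fun z z' => by
    rw [rankOne_apply, rankOne_apply, ip_rsmul_left, ip_rsmul_right, star_ip]

theorem mul_rankOne (T : Adjointable A V) (v w : V) : T * rankOne v w = rankOne (T.1 v) w := by
  refine Subtype.ext <| adjointable_ext (A := A) fun z z' => ?_
  change (ip z (T.1 (rsmul v (ip w z' : A))) : A) = ip z (rsmul (T.1 v) (ip w z' : A))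
  rw [ip_apply_right, ip_rsmul_right, ip_rsmul_right, ip_apply_right]

variable (A V) in
/-- The `⋆`-algebra of finite-rank operators, the linear span of the `θ_{v,w}`. -/
noncomputable def finiteRank : NonUnitalStarSubalgebra ℂ (Adjointable A V) where
  __ := Submodule.span ℂ {T : Adjointable A V | ∃ v w : V, rankOne v w = T}
  mul_mem' := by
    intro S T _ hT
    induction hT using Submodule.span_induction with
    | mem T h =>
      obtain ⟨v, w, rfl⟩ := h
      exact Submodule.subset_span ⟨S.1 v, w, (mul_rankOne S v w).symm⟩
    | zero => rw [mul_zero]; exact Submodule.zero_mem _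
    | add T T' _ _ h h' => rw [mul_add]; exact Submodule.add_mem _ h h'
    | smul c T _ h => rw [mul_smul_comm]; exact Submodule.smul_mem _ c h
  star_mem' := by
    intro T hT
    induction hT using Submodule.span_induction with
    | mem T h =>
      obtain ⟨v, w, rfl⟩ := h
      exact Submodule.subset_span ⟨w, v, (star_rankOne v w).symm⟩
    | zero => rw [star_zero]; exact Submodule.zero_mem _
    | add T T' _ _ h h' => rw [star_add]; exact Submodule.add_mem _ h h'
    | smul c T _ h => rw [star_smul]; exact Submodule.smul_mem _ _ h

variable (A V) in
/-- The `C⋆`-algebra `K(V)` of compact operators, the closed linear span of the `θ_{v,w}`. -/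
abbrev CompactOperators : Type _ := (finiteRank A V).topologicalClosure

noncomputable instance : NonUnitalCStarAlgebra (CompactOperators A V) :=
  NonUnitalStarSubalgebra.nonUnitalCStarAlgebra _
    (h_closed := NonUnitalStarSubalgebra.isClosed_topologicalClosure _)

noncomputable instance : PartialOrder (CompactOperators A V) := CStarAlgebra.spectralOrder _

instance : StarOrderedRing (CompactOperators A V) := CStarAlgebra.spectralOrderedRing _

end Operators

end HilbertModule

/-- An `A`–`B`-imprimitivity bimodule: an `A`–`B`-bimodule that is a full right Hilbert `B`-module
and a full left Hilbert `A`-module, such that `⟨a x, y⟩_B = ⟨x, a⋆ y⟩_B`, `_A⟨x b, y⟩ = _A⟨x, y b⋆⟩`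
and `_A⟨x, y⟩ z = x ⟨y, z⟩_B`.  The norm `‖_A⟨x, x⟩‖ ^ (1/2)` of the left module is the norm of the
right module, by `ImprimitivityBimodule.norm_sq_eq_lip` below, so that completeness in it need not
be required separately. -/
structure ImprimitivityBimodule (A B : Type u) [NonUnitalCStarAlgebra A] [PartialOrder A]
    [StarOrderedRing A] [NonUnitalCStarAlgebra B] [PartialOrder B] [StarOrderedRing B] where
  carrier : Type u
  [normedAddCommGroup : NormedAddCommGroup carrier]
  [normedSpace : NormedSpace ℂ carrier]
  [right : HilbertModule B carrier]
  /-- the left action `(a, x) ↦ a x` -/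
  lsmul : A → carrier → carrier
  add_lsmul : ∀ a b x, lsmul (a + b) x = lsmul a x + lsmul b x
  lsmul_add : ∀ a x y, lsmul a (x + y) = lsmul a x + lsmul a y
  mul_lsmul : ∀ a b x, lsmul (a * b) x = lsmul a (lsmul b x)
  smul_lsmul : ∀ (c : ℂ) a x, lsmul (c • a) x = c • lsmul a x
  lsmul_smul : ∀ (c : ℂ) a x, lsmul a (c • x) = c • lsmul a x
  lsmul_rsmul : ∀ a x (b : B),
    lsmul a (HilbertModule.rsmul x b) = HilbertModule.rsmul (lsmul a x) b
  /-- the left inner product `_A⟨x, y⟩`, linear in the first variable -/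
  lip : carrier → carrier → A
  lip_add_left : ∀ x x' y, lip (x + x') y = lip x y + lip x' y
  lip_smul_left : ∀ (c : ℂ) x y, lip (c • x) y = c • lip x y
  lip_lsmul_left : ∀ a x y, lip (lsmul a x) y = a * lip x y
  star_lip : ∀ x y, star (lip x y) = lip y x
  lip_self_nonneg : ∀ x, 0 ≤ lip x x
  lip_self_eq_zero : ∀ x, lip x x = 0 → x = 0
  full_left : Dense (Submodule.span ℂ {a : A | ∃ x y, lip x y = a} : Set A)
  full_right : IsFull B carrier
  ip_lsmul_left : ∀ a x y,
    (HilbertModule.ip (lsmul a x) y : B) = HilbertModule.ip x (lsmul (star a) y)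
  lip_rsmul_left : ∀ x y (b : B),
    lip (HilbertModule.rsmul x b) y = lip x (HilbertModule.rsmul y (star b))
  lip_lsmul : ∀ x y z, lsmul (lip x y) z = HilbertModule.rsmul x (HilbertModule.ip y z : B)

namespace ImprimitivityBimodule

open HilbertModule

variable {A B : Type u} [NonUnitalCStarAlgebra A] [PartialOrder A] [StarOrderedRing A]
  [NonUnitalCStarAlgebra B] [PartialOrder B] [StarOrderedRing B] (X : ImprimitivityBimodule A B)

instance : NormedAddCommGroup X.carrier := X.normedAddCommGroup

instance : NormedSpace ℂ X.carrier := X.normedSpace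

instance : HilbertModule B X.carrier := X.right

/-- The operator `x ↦ a x`. -/
def lsmulₗ (a : A) : X.carrier →ₗ[ℂ] X.carrier where
  toFun := X.lsmul a
  map_add' := X.lsmul_add a
  map_smul' c x := X.lsmul_smul c a x

/-- The operator `x ↦ a x` as a bounded operator. -/
noncomputable def lsmulL (a : A) : X.carrier →L[ℂ] X.carrier :=
  have : CompleteSpace X.carrier := complete B
  ⟨X.lsmulₗ a, by
    refine LinearMap.continuous_of_seq_closed_graph (X.lsmulₗ a) fun u x y hu hy => ?_
    refine ext_ip B fun z => ?_
    have h1 : Filter.Tendsto (fun n => ipSL B X.carrier z (X.lsmul a (u n))) Filter.atTop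
        (nhds (ipSL B X.carrier z y)) := ((ipSL B X.carrier z).continuous.tendsto y).comp hy
    have h2 : Filter.Tendsto (fun n => ipSL B X.carrier (X.lsmul (star a) z) (u n)) Filter.atTop
        (nhds (ipSL B X.carrier (X.lsmul (star a) z) x)) :=
      ((ipSL B X.carrier (X.lsmul (star a) z)).continuous.tendsto x).comp hu
    have h3 : ∀ w, (ip (X.lsmul (star a) z) w : B) = ip z (X.lsmul a w) := fun w => by
      rw [X.ip_lsmul_left, star_star]
    rw [show (ip z (X.lsmulₗ a x) : B) = ip (X.lsmul (star a) z) x from (h3 x).symm]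
    exact tendsto_nhds_unique h1 (h2.congr fun n => h3 (u n))⟩

/-- The left action as a `⋆`-homomorphism `A → L(X_B)`. -/
noncomputable def leftAction : A →⋆ₙₐ[ℂ] Adjointable B X.carrier where
  toFun a := ⟨X.lsmulL a, X.lsmulL (star a), X.ip_lsmul_left a⟩
  map_smul' c a := Subtype.ext <| ContinuousLinearMap.ext fun x => X.smul_lsmul c a x
  map_zero' := Subtype.ext <| ContinuousLinearMap.ext fun x => by
    have := X.smul_lsmul 0 0 x
    rw [zero_smul, zero_smul] at this
    exact this
  map_add' a b := Subtype.ext <| ContinuousLinearMap.ext fun x => X.add_lsmul a b x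
  map_mul' a b := Subtype.ext <| ContinuousLinearMap.ext fun x => X.mul_lsmul a b x
  map_star' a := (star_eq_of_forall fun x y => X.ip_lsmul_left a x y).symm

theorem leftAction_apply (a : A) (x : X.carrier) : (X.leftAction a).1 x = X.lsmul a x := rfl

theorem lip_add_right (x y y' : X.carrier) : X.lip x (y + y') = X.lip x y + X.lip x y' := by
  rw [← X.star_lip (y + y'), X.lip_add_left, star_add, X.star_lip, X.star_lip]

theorem lip_smul_right (c : ℂ) (x y : X.carrier) : X.lip x (c • y) = star c • X.lip x y := by
  rw [← X.star_lip (c • y), X.lip_smul_left, star_smul, X.star_lip]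

theorem lip_lsmul_right (a : A) (x y : X.carrier) : X.lip x (X.lsmul a y) = X.lip x y * star a := by
  rw [← X.star_lip (X.lsmul a y), X.lip_lsmul_left, star_mul, X.star_lip]

theorem leftAction_injective : Function.Injective X.leftAction := by
  rw [injective_iff_map_eq_zero]
  intro a ha
  have h0 : ∀ x, X.lsmul a x = 0 := fun x => by
    rw [← leftAction_apply, ha]; rfl
  have hz : ∀ y, X.lip 0 y = 0 := fun y => by
    have := X.lip_smul_left 0 0 y
    rwa [zero_smul, zero_smul] at this
  have h1 : ∀ b : A, a * b = 0 := by
    have hc : IsClosed {b : A | a * b = 0} := isClosed_eq (by fun_prop) continuous_const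
    have hs : (Submodule.span ℂ {a : A | ∃ x y, X.lip x y = a} : Set A) ⊆ {b : A | a * b = 0} := by
      intro b hb
      induction hb using Submodule.span_induction with
      | mem b h =>
        obtain ⟨x, y, rfl⟩ := h
        change a * _ = 0
        rw [← X.lip_lsmul_left, h0, hz]
      | zero => exact mul_zero a
      | add b b' _ _ h h' =>
        change a * _ = 0
        rw [mul_add, h, h', add_zero]
      | smul c b _ h =>
        change a * _ = 0
        rw [mul_smul_comm, h, smul_zero]
    intro b
    exact (hc.closure_subset_iff.mpr hs) (X.full_left b)
  exact CStarRing.mul_star_self_eq_zero_iff a |>.mp (h1 (star a))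

theorem leftAction_lip (x y : X.carrier) : X.leftAction (X.lip x y) = rankOne x y :=
  Subtype.ext <| ContinuousLinearMap.ext fun z => X.lip_lsmul x y z

/-- The norms of the left and of the right Hilbert module coincide. -/
theorem norm_sq_eq_lip (x : X.carrier) : ‖x‖ ^ 2 = ‖X.lip x x‖ := by
  rw [← NonUnitalStarAlgHom.norm_map X.leftAction X.leftAction_injective, leftAction_lip]
  apply le_antisymm
  · rcases eq_or_ne x 0 with rfl | hx
    · simp
    have hx' : 0 < ‖x‖ ^ 2 := by positivity
    have h1 : (ip x ((rankOne x x : Adjointable B X.carrier).1 x) : B)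
        = star (ip x x : B) * ip x x := by
      rw [rankOne_apply, ip_rsmul_right, star_ip]
    have h2 : ‖x‖ ^ 2 * ‖x‖ ^ 2 ≤ ‖x‖ * (‖(rankOne x x : Adjointable B X.carrier)‖ * ‖x‖) := by
      calc ‖x‖ ^ 2 * ‖x‖ ^ 2 = ‖(ip x ((rankOne x x : Adjointable B X.carrier).1 x) : B)‖ := by
            rw [h1, CStarRing.norm_star_mul_self, norm_sq_eq (A := B)]
        _ ≤ ‖x‖ * ‖(rankOne x x : Adjointable B X.carrier).1 x‖ := norm_ip_le _ _
        _ ≤ _ := by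
          gcongr
          exact (rankOne x x : Adjointable B X.carrier).1.le_opNorm x
    refine le_of_mul_le_mul_left ?_ hx'
    linarith
  · refine ContinuousLinearMap.opNorm_le_bound _ (by positivity) fun z => ?_
    change ‖(rsmul x (ip x z : B) : X.carrier)‖ ≤ ‖x‖ ^ 2 * ‖z‖
    calc _ ≤ ‖x‖ * ‖(ip x z : B)‖ := norm_rsmul_le _ _
      _ ≤ ‖x‖ * (‖x‖ * ‖z‖) := by gcongr; exact norm_ip_le _ _
      _ = _ := by ring

/-- The conjugate vector space of `X`, underlying the dual module. -/
def Conj : Type u := X.carrier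

/-- The conjugate linear bijection `b` from `X` to its conjugate space. -/
def toConj (x : X.carrier) : X.Conj := x

/-- The inverse of `b`. -/
def ofConj (x : X.Conj) : X.carrier := x

noncomputable instance : NormedAddCommGroup X.Conj := inferInstanceAs (NormedAddCommGroup X.carrier)

noncomputable instance : Module ℂ X.Conj := Module.compHom X.carrier (starRingEnd ℂ)

theorem conj_smul (c : ℂ) (x : X.carrier) : c • X.toConj x = X.toConj (star c • x) := rfl

noncomputable instance : NormedSpace ℂ X.Conj where
  norm_smul_le c x := by
    change ‖star c • X.ofConj x‖ ≤ ‖c‖ * ‖X.ofConj x‖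
    rw [norm_smul, norm_star]

/-- `X̃` as a right Hilbert `A`-module: `b(x) a = b(a⋆ x)`, `⟨b(x), b(y)⟩_A = _A⟨x, y⟩`. -/
noncomputable instance : HilbertModule A X.Conj where
  complete := complete B (V := X.carrier)
  rsmul x a := X.toConj (X.lsmul (star a) (X.ofConj x))
  add_rsmul x y a := X.lsmul_add _ _ _
  rsmul_add x a b := by rw [star_add]; exact X.add_lsmul _ _ _
  rsmul_mul x a b := by rw [star_mul]; exact X.mul_lsmul _ _ _
  smul_rsmul c x a := X.lsmul_smul (star c) _ _
  rsmul_smul c x a := by rw [star_smul]; exact X.smul_lsmul (star c) _ _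
  ip x y := X.lip (X.ofConj x) (X.ofConj y)
  ip_add_right x y z := X.lip_add_right _ _ _
  ip_smul_right c x y := (X.lip_smul_right (star c) _ _).trans (by rw [star_star]; rfl)
  ip_rsmul_right x y a := (X.lip_lsmul_right (star a) _ _).trans (by rw [star_star])
  star_ip x y := X.star_lip _ _
  ip_self_nonneg x := X.lip_self_nonneg _
  ip_self_eq_zero x := X.lip_self_eq_zero _
  norm_sq_eq x := X.norm_sq_eq_lip _

/-- The dual module `X̃`, a `B`–`A`-imprimitivity bimodule: `b b(x) = b(x b⋆)`,
`_B⟨b(x), b(y)⟩ = ⟨x, y⟩_B`. -/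
noncomputable def dual : ImprimitivityBimodule B A where
  carrier := X.Conj
  lsmul b x := X.toConj (rsmul (X.ofConj x) (star b))
  add_lsmul a b x := by rw [star_add]; exact rsmul_add (X.ofConj x) _ _
  lsmul_add a x y := add_rsmul (X.ofConj x) (X.ofConj y) _
  mul_lsmul a b x := by rw [star_mul]; exact rsmul_mul (X.ofConj x) _ _
  smul_lsmul c a x := by rw [star_smul]; exact rsmul_smul (star c) (X.ofConj x) _
  lsmul_smul c a x := smul_rsmul (star c) (X.ofConj x) _
  lsmul_rsmul b x a := (X.lsmul_rsmul (star a) (X.ofConj x) (star b)).symm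
  lip x y := ip (X.ofConj x) (X.ofConj y)
  lip_add_left x x' y := ip_add_left (X.ofConj x) (X.ofConj x') (X.ofConj y)
  lip_smul_left c x y := (ip_smul_left (star c) (X.ofConj x) (X.ofConj y)).trans (by rw [star_star])
  lip_lsmul_left b x y := (ip_rsmul_left (X.ofConj x) (X.ofConj y) (star b)).trans (by rw [star_star])
  star_lip x y := star_ip (X.ofConj x) (X.ofConj y)
  lip_self_nonneg x := ip_self_nonneg _
  lip_self_eq_zero x := ip_self_eq_zero (A := B) (V := X.carrier) x
  full_left := X.full_right
  full_right := X.full_left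
  ip_lsmul_left b x y := X.lip_rsmul_left _ _ _
  lip_rsmul_left x y a := X.ip_lsmul_left _ _ _
  lip_lsmul x y z := by
    change X.toConj (rsmul (X.ofConj z) (star (ip (X.ofConj x) (X.ofConj y)))) =
      X.toConj (X.lsmul (star (X.lip (X.ofConj y) (X.ofConj z))) (X.ofConj x))
    rw [star_ip, X.star_lip, X.lip_lsmul]

/-- An approximate unit of `A` acts as an approximate unit on `X`. -/
theorem tendsto_lsmul (x : X.carrier) :
    Filter.Tendsto (fun e => X.lsmul e x) (CStarAlgebra.approximateUnit A) (nhds x) := by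
  have hA := CStarAlgebra.increasingApproximateUnit A
  have h1 : ∀ e : A, ‖X.lsmul e x - x‖ ^ 2 =
      ‖(e * X.lip x x - X.lip x x) * star e - (e * X.lip x x - X.lip x x)‖ := fun e => by
    rw [X.norm_sq_eq_lip, show X.lsmul e x - x = X.lsmul e x + (-1 : ℂ) • x by
      rw [neg_one_smul, sub_eq_add_neg]]
    simp only [X.lip_add_left, X.lip_add_right, X.lip_smul_left, X.lip_smul_right,
      X.lip_lsmul_left, X.lip_lsmul_right]
    congr 1
    simp only [star_neg, star_one, neg_smul, one_smul, sub_mul, neg_neg, mul_assoc]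
    abel
  have h2 : Filter.Tendsto (fun e : A => √(2 * ‖e * X.lip x x - X.lip x x‖))
      (CStarAlgebra.approximateUnit A) (nhds 0) := by
    have h3 := (tendsto_iff_norm_sub_tendsto_zero.mp (hA.tendsto_mul_right (X.lip x x)))
    simpa using (h3.const_mul 2).sqrt
  rw [tendsto_iff_norm_sub_tendsto_zero]
  refine squeeze_zero' (.of_forall fun _ => norm_nonneg _) ?_ h2
  filter_upwards [hA.eventually_norm] with e he
  refine Real.le_sqrt_of_sq_le ?_
  rw [h1]
  set d := e * X.lip x x - X.lip x x
  calc ‖d * star e - d‖ ≤ ‖d‖ * ‖star e‖ + ‖d‖ :=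
        (norm_sub_le _ _).trans (by gcongr; exact norm_mul_le _ _)
    _ ≤ ‖d‖ * 1 + ‖d‖ := by rw [norm_star]; gcongr
    _ = 2 * ‖d‖ := by ring

end ImprimitivityBimodule

/-- Two `C⋆`-algebras are Morita equivalent if there is an imprimitivity bimodule between them. -/
def MoritaEquivalent (A B : Type u) [NonUnitalCStarAlgebra A] [PartialOrder A]
    [StarOrderedRing A] [NonUnitalCStarAlgebra B] [PartialOrder B] [StarOrderedRing B] : Prop :=
  Nonempty (ImprimitivityBimodule A B)

section Gram

variable {A V : Type*} [NonUnitalCStarAlgebra A] [PartialOrder A] [StarOrderedRing A]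
  [NormedAddCommGroup V] [NormedSpace ℂ V] [HilbertModule A V]

/-- The consequences of the decomposition `M = M⁺ - M⁻` needed below, with `N = M⁻`. -/
theorem exists_negPart_aux {C : Type*} [NonUnitalCStarAlgebra C] [PartialOrder C]
    [StarOrderedRing C] (M : C) (hM : IsSelfAdjoint M) :
    ∃ N S : C, star N = N ∧ N * M * N = -(star (S * N) * (S * N)) ∧
      (S * N = 0 → ∃ R, M = star R * R) := by
  have hN : 0 ≤ M⁻ := CFC.negPart_nonneg M
  have hNsa : star M⁻ = M⁻ := hN.isSelfAdjoint
  obtain ⟨S, hS⟩ := CStarAlgebra.nonneg_iff_eq_star_mul_self.mp hN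
  refine ⟨M⁻, S, hNsa, ?_, fun h5 => ?_⟩
  · have h2 : M⁻ * M = -(M⁻ * M⁻) := by
      have h := congrArg (M⁻ * ·) (CFC.posPart_sub_negPart M hM)
      simp only [mul_sub, CFC.negPart_mul_posPart, zero_sub] at h
      exact h.symm
    have h3 : star (S * M⁻) * (S * M⁻) = M⁻ * (star S * S) * M⁻ := by
      rw [star_mul, hNsa]; simp only [mul_assoc]
    rw [h2, h3, ← hS, neg_mul]
  · have h6 : M⁻ = 0 := by
      have h7 : star M⁻ * M⁻ = 0 := by
        rw [hNsa]
        nth_rw 1 [hS]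
        rw [mul_assoc, h5, mul_zero]
      exact CStarRing.star_mul_self_eq_zero_iff _ |>.mp h7
    have h7 : 0 ≤ M := by
      have := CFC.posPart_sub_negPart M hM
      rw [h6, sub_zero] at this
      rw [← this]
      exact CFC.posPart_nonneg M
    exact CStarAlgebra.nonneg_iff_eq_star_mul_self.mp h7

/-- Gram matrices over a `C⋆`-algebra are positive, that is, of the form `R⋆ R`. -/
theorem HilbertModule.exists_gram {ι : Type*} [Fintype ι] (x : ι → V) :
    ∃ R : ι → ι → A, ∀ i j, (HilbertModule.ip (x i) (x j) : A) = ∑ k, star (R k i) * R k j := by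
  let M : CStarMatrix ι ι A := CStarMatrix.ofMatrix fun i j => HilbertModule.ip (x i) (x j)
  have hM : IsSelfAdjoint M := by
    ext i j
    exact HilbertModule.star_ip _ _
  obtain ⟨N, S, hNsa, h1, hfin⟩ := exists_negPart_aux M hM
  have hNent : ∀ i k, star (N i k) = N k i := fun i k => by
    conv_rhs => rw [← hNsa]
    rfl
  have h4 : ∀ k, (0 : A) ≤ (N * M * N) k k := fun k => by
    have : (N * M * N) k k = HilbertModule.ip (∑ i, HilbertModule.rsmul (x i) (N i k))
        (∑ i, HilbertModule.rsmul (x i) (N i k)) := by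
      rw [HilbertModule.ip_sum_right, CStarMatrix.mul_apply]
      refine Finset.sum_congr rfl fun j _ => ?_
      rw [HilbertModule.ip_rsmul_right, HilbertModule.ip_sum_left, CStarMatrix.mul_apply]
      congr 1
      refine Finset.sum_congr rfl fun i _ => ?_
      rw [HilbertModule.ip_rsmul_left, hNent]
      rfl
    rw [this]
    exact HilbertModule.ip_self_nonneg _
  have h5 : S * N = 0 := by
    ext i k
    have h6 : (star (S * N) * (S * N)) k k = ∑ i, star ((S * N) i k) * (S * N) i k := by
      rw [CStarMatrix.mul_apply]; rfl
    have h7 : ∑ i, star ((S * N) i k) * (S * N) i k ≤ 0 := by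
      have := h4 k
      rw [h1, CStarMatrix.neg_apply, h6] at this
      exact neg_nonneg.mp this
    have h8 : ∑ i, star ((S * N) i k) * (S * N) i k = 0 :=
      le_antisymm h7 (Finset.sum_nonneg fun i _ => star_mul_self_nonneg _)
    have h9 := (Finset.sum_eq_zero_iff_of_nonneg fun i _ => star_mul_self_nonneg _).mp h8 i
      (Finset.mem_univ i)
    exact CStarRing.star_mul_self_eq_zero_iff _ |>.mp h9
  obtain ⟨R, hR⟩ := hfin h5
  refine ⟨fun i j => R i j, fun i j => ?_⟩
  change M i j = _
  rw [hR, CStarMatrix.mul_apply]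
  rfl

end Gram

section InteriorTensor

open HilbertModule

variable {B H : Type*} [NonUnitalCStarAlgebra B] [PartialOrder B] [StarOrderedRing B]
  [NormedAddCommGroup H] [InnerProductSpace ℂ H] [CompleteSpace H]
  (X : Type*) [NormedAddCommGroup X] [NormedSpace ℂ X] [HilbertModule B X]
  (φ : B →⋆ₙₐ[ℂ] (H →L[ℂ] H))

set_option linter.unusedVariables false in
/-- The algebraic tensor product `X ⊗ H`, to be given the semi-inner product
`⟪x ⊗ h, y ⊗ k⟫ = ⟪h, φ(⟨x, y⟩_B) k⟫`. -/
def PreTensor (φ : B →⋆ₙₐ[ℂ] (H →L[ℂ] H)) := X ⊗[ℂ] H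

namespace PreTensor

noncomputable instance : AddCommGroup (PreTensor X φ) := inferInstanceAs (AddCommGroup (X ⊗[ℂ] H))

noncomputable instance : Module ℂ (PreTensor X φ) := inferInstanceAs (Module ℂ (X ⊗[ℂ] H))

variable {X} in
/-- The elementary tensor `x ⊗ h`. -/
def tmul (x : X) (h : H) : PreTensor X φ := x ⊗ₜ[ℂ] h

variable {X} in
/-- `y ⊗ k ↦ ⟪h, φ(⟨x, y⟩) k⟫`. -/
noncomputable def formAux (x : X) (h : H) : X ⊗[ℂ] H →ₗ[ℂ] ℂ :=
  TensorProduct.lift <| LinearMap.mk₂ ℂ (fun y k => ⟪h, φ (ip x y) k⟫_ℂ)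
    (fun y y' k => by simp [ip_add_right])
    (fun c y k => by simp [ip_smul_right])
    (fun y k k' => by simp)
    (fun c y k => by simp)

/-- The semi-inner product of `X ⊗ H`. -/
noncomputable def form : PreTensor X φ →ₗ⋆[ℂ] PreTensor X φ →ₗ[ℂ] ℂ :=
  TensorProduct.lift <| LinearMap.mk₂'ₛₗ (starRingEnd ℂ) (starRingEnd ℂ) (formAux φ)
    (fun x x' h => TensorProduct.ext' fun y k => by
      change ⟪h, φ (ip (x + x') y) k⟫_ℂ = ⟪h, φ (ip x y) k⟫_ℂ + ⟪h, φ (ip x' y) k⟫_ℂ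
      simp [ip_add_left])
    (fun c x h => TensorProduct.ext' fun y k => by
      change ⟪h, φ (ip (c • x) y) k⟫_ℂ = starRingEnd ℂ c * ⟪h, φ (ip x y) k⟫_ℂ
      simp [ip_smul_left])
    (fun x h h' => TensorProduct.ext' fun y k => inner_add_left _ _ _)
    (fun c x h => TensorProduct.ext' fun y k => inner_smul_left _ _ _)

variable {X}

theorem form_tmul (x y : X) (h k : H) :
    form X φ (tmul φ x h) (tmul φ y k) = ⟪h, φ (ip x y) k⟫_ℂ := rfl

@[elab_as_elim]
theorem induction {p : PreTensor X φ → Prop} (t : PreTensor X φ) (zero : p 0)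
    (tmul : ∀ x h, p (tmul φ x h)) (add : ∀ s t, p s → p t → p (s + t)) : p t :=
  TensorProduct.induction_on t zero tmul add

theorem exists_sum (t : PreTensor X φ) :
    ∃ (n : ℕ) (x : Fin n → X) (h : Fin n → H), t = ∑ i, tmul φ (x i) (h i) := by
  obtain ⟨S, hS⟩ := TensorProduct.exists_finset t
  refine ⟨S.card, fun i => (S.equivFin.symm i).1.1, fun i => (S.equivFin.symm i).1.2, ?_⟩
  rw [hS, ← Finset.sum_coe_sort]
  exact (Equiv.sum_comp S.equivFin.symm fun p : S => tmul φ p.1.1 p.1.2).symm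

theorem conj_form (s t : PreTensor X φ) : starRingEnd ℂ (form X φ t s) = form X φ s t := by
  induction s using induction with
  | zero => simp
  | add s s' h h' => simp [h, h']
  | tmul x h =>
    induction t using induction with
    | zero => simp
    | add s s' h h' => simp [h, h']
    | tmul y k =>
      rw [form_tmul, form_tmul, inner_conj_symm, ← star_ip x y, map_star,
        ContinuousLinearMap.star_eq_adjoint, ContinuousLinearMap.adjoint_inner_left]

theorem form_sum {ι : Type*} [Fintype ι] {x : ι → X} {R : ι → ι → B}
    (hR : ∀ i j, (ip (x i) (x j) : B) = ∑ k, star (R k i) * R k j) (h : ι → H) :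
    form X φ (∑ i, tmul φ (x i) (h i)) (∑ i, tmul φ (x i) (h i)) =
      ((∑ k, ‖∑ j, φ (R k j) (h j)‖ ^ 2 : ℝ) : ℂ) := by
  have h1 : ∀ k, ((‖∑ j, φ (R k j) (h j)‖ ^ 2 : ℝ) : ℂ) =
      ∑ i, ∑ j, ⟪h i, φ (star (R k i) * R k j) (h j)⟫_ℂ := fun k => by
    rw [Complex.ofReal_pow, ← Complex.coe_algebraMap, ← inner_self_eq_norm_sq_to_K, sum_inner]
    refine Finset.sum_congr rfl fun i _ => ?_
    rw [inner_sum]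
    refine Finset.sum_congr rfl fun j _ => ?_
    rw [map_mul, map_star, ContinuousLinearMap.star_eq_adjoint, mul_apply_eq_comp,
      ContinuousLinearMap.adjoint_inner_right]
  rw [Complex.ofReal_sum, Finset.sum_congr rfl fun k _ => h1 k, Finset.sum_comm,
    map_sum (form X φ), LinearMap.sum_apply]
  refine Finset.sum_congr rfl fun i _ => ?_
  rw [map_sum, Finset.sum_comm]
  refine Finset.sum_congr rfl fun j _ => ?_
  rw [form_tmul, hR, map_sum, sum_apply, inner_sum]

theorem form_self_nonneg (t : PreTensor X φ) : 0 ≤ (form X φ t t).re := by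
  obtain ⟨n, x, h, rfl⟩ := exists_sum φ t
  obtain ⟨R, hR⟩ := exists_gram (A := B) x
  rw [form_sum φ hR, Complex.ofReal_re]
  positivity

/-- The semi-inner product of `X ⊗ H`. -/
noncomputable abbrev core : PreInnerProductSpace.Core ℂ (PreTensor X φ) where
  inner s t := form X φ s t
  conj_inner_symm s t := conj_form φ s t
  re_inner_nonneg t := form_self_nonneg φ t
  add_left s s' t := by rw [map_add, LinearMap.add_apply]
  smul_left s t c := by rw [map_smulₛₗ, LinearMap.smul_apply, smul_eq_mul]

noncomputable instance : SeminormedAddCommGroup (PreTensor X φ) :=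
  InnerProductSpace.Core.toSeminormedAddCommGroup (c := core φ)

noncomputable instance : InnerProductSpace ℂ (PreTensor X φ) := InnerProductSpace.ofCore (core φ)

theorem inner_tmul (x y : X) (h k : H) :
    ⟪tmul φ x h, tmul φ y k⟫_ℂ = ⟪h, φ (ip x y) k⟫_ℂ := rfl

theorem norm_sq_sum {ι : Type*} [Fintype ι] {x : ι → X} {R : ι → ι → B}
    (hR : ∀ i j, (ip (x i) (x j) : B) = ∑ k, star (R k i) * R k j) (h : ι → H) :
    ‖∑ i, tmul φ (x i) (h i)‖ ^ 2 = ∑ k, ‖∑ j, φ (R k j) (h j)‖ ^ 2 := by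
  have := form_sum φ hR h
  have h2 := inner_self_eq_norm_sq_to_K (𝕜 := ℂ) (∑ i, tmul φ (x i) (h i))
  rw [← Complex.ofReal_inj, Complex.ofReal_pow]
  exact h2.symm.trans this

/-- `T ⊗ 1` on `X ⊗ H`, for an adjointable operator `T` on `X`. -/
noncomputable def mapLeftₗ (T : Adjointable B X) : PreTensor X φ →ₗ[ℂ] PreTensor X φ :=
  LinearMap.rTensor H (T.1 : X →ₗ[ℂ] X)

theorem mapLeftₗ_tmul (T : Adjointable B X) (x : X) (h : H) :
    mapLeftₗ φ T (tmul φ x h) = tmul φ (T.1 x) h := rfl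

theorem mapLeftₗ_mul (S T : Adjointable B X) (t : PreTensor X φ) :
    mapLeftₗ φ (S * T) t = mapLeftₗ φ S (mapLeftₗ φ T t) := by
  induction t using induction with
  | zero => simp
  | add s t h h' => simp [h, h']
  | tmul x h => rfl

theorem mapLeftₗ_add (S T : Adjointable B X) (t : PreTensor X φ) :
    mapLeftₗ φ (S + T) t = mapLeftₗ φ S t + mapLeftₗ φ T t := by
  induction t using induction with
  | zero => simp
  | add s t h h' => simp only [map_add, h, h']; abel
  | tmul x h => exact TensorProduct.add_tmul _ _ _

theorem mapLeftₗ_smul (c : ℂ) (T : Adjointable B X) (t : PreTensor X φ) :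
    mapLeftₗ φ (c • T) t = c • mapLeftₗ φ T t := by
  induction t using induction with
  | zero => simp
  | add s t h h' => simp [h, h']
  | tmul x h => rfl

theorem mapLeftₗ_one (t : PreTensor X φ) : mapLeftₗ φ 1 t = t := by
  induction t using induction with
  | zero => simp
  | add s t h h' => simp [h, h']
  | tmul x h => rfl

theorem inner_mapLeftₗ (T : Adjointable B X) (s t : PreTensor X φ) :
    ⟪mapLeftₗ φ T s, t⟫_ℂ = ⟪s, mapLeftₗ φ (star T) t⟫_ℂ := by
  induction s using induction with
  | zero => simp
  | add s s' h h' => simp [inner_add_left, h, h']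
  | tmul x h =>
    induction t using induction with
    | zero => simp
    | add s s' h h' => simp [inner_add_right, h, h']
    | tmul y k =>
      rw [mapLeftₗ_tmul, mapLeftₗ_tmul, inner_tmul, inner_tmul, ip_apply_left]

theorem norm_mapLeftₗ_le (T : Adjointable B X) (t : PreTensor X φ) :
    ‖mapLeftₗ φ T t‖ ≤ ‖T‖ * ‖t‖ := by
  let _ : PartialOrder (Adjointable B X) := CStarAlgebra.spectralOrder _
  have : StarOrderedRing (Adjointable B X) := CStarAlgebra.spectralOrderedRing _
  have h1 : 0 ≤ algebraMap ℝ (Adjointable B X) (‖T‖ ^ 2) - star T * T :=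
    sub_nonneg.mpr CStarAlgebra.star_mul_le_algebraMap_norm_sq
  obtain ⟨C, hC⟩ := CStarAlgebra.nonneg_iff_eq_star_mul_self.mp h1
  have h2 : star T * T + star C * C = ((‖T‖ ^ 2 : ℝ) : ℂ) • 1 := by
    rw [← hC, add_sub_cancel, Algebra.algebraMap_eq_smul_one, Complex.coe_smul]
  have h3 : ∀ S : Adjointable B X,
      ⟪t, mapLeftₗ φ (star S * S) t⟫_ℂ = ((‖mapLeftₗ φ S t‖ ^ 2 : ℝ) : ℂ) :=
    fun S => by
      rw [mapLeftₗ_mul, ← inner_mapLeftₗ, inner_self_eq_norm_sq_to_K]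
      norm_cast
  have h4 : ‖mapLeftₗ φ T t‖ ^ 2 + ‖mapLeftₗ φ C t‖ ^ 2 = ‖T‖ ^ 2 * ‖t‖ ^ 2 := by
    have h5 : ⟪t, mapLeftₗ φ (star T * T + star C * C) t⟫_ℂ = ((‖T‖ ^ 2 * ‖t‖ ^ 2 : ℝ) : ℂ) := by
      rw [h2, mapLeftₗ_smul, mapLeftₗ_one, inner_smul_right, inner_self_eq_norm_sq_to_K,
        Complex.ofReal_mul, Complex.ofReal_pow ‖t‖]
      rfl
    rw [mapLeftₗ_add, inner_add_right, h3, h3] at h5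
    exact_mod_cast h5
  refine le_of_sq_le_sq ?_ (by positivity)
  rw [mul_pow]
  nlinarith [sq_nonneg ‖mapLeftₗ φ C t‖]

/-- `T ⊗ 1` as a bounded operator. -/
noncomputable def mapLeft (T : Adjointable B X) : PreTensor X φ →L[ℂ] PreTensor X φ :=
  (mapLeftₗ φ T).mkContinuous ‖T‖ (norm_mapLeftₗ_le φ T)

variable {φ}
variable {H' : Type*} [NormedAddCommGroup H'] [InnerProductSpace ℂ H'] [CompleteSpace H']
  {φ' : B →⋆ₙₐ[ℂ] (H' →L[ℂ] H')}

variable (X) in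
/-- `1 ⊗ S` on `X ⊗ H`, for an operator `S` that intertwines two representations of `B`. -/
noncomputable def mapRight (S : H →L[ℂ] H') (hS : ∀ b h, S (φ b h) = φ' b (S h)) :
    PreTensor X φ →L[ℂ] PreTensor X φ' :=
  LinearMap.mkContinuous (LinearMap.lTensor X (S : H →ₗ[ℂ] H') :) ‖S‖ fun t => by
    obtain ⟨n, x, h, rfl⟩ := exists_sum φ t
    obtain ⟨R, hR⟩ := exists_gram (A := B) x
    refine le_of_sq_le_sq ?_ (by positivity)
    change ‖(show PreTensor X φ' from
      LinearMap.lTensor X (S : H →ₗ[ℂ] H') (∑ i, x i ⊗ₜ[ℂ] h i))‖ ^ 2 ≤ _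
    have h1 : (show PreTensor X φ' from LinearMap.lTensor X (S : H →ₗ[ℂ] H') (∑ i, x i ⊗ₜ[ℂ] h i)) =
        ∑ i, tmul φ' (x i) (S (h i)) := map_sum (LinearMap.lTensor X (S : H →ₗ[ℂ] H')) _ _
    rw [h1, mul_pow, norm_sq_sum φ hR, norm_sq_sum φ' hR, Finset.mul_sum]
    refine Finset.sum_le_sum fun k _ => ?_
    rw [← mul_pow]
    gcongr
    refine le_trans (le_of_eq ?_) (S.le_opNorm _)
    rw [map_sum]
    simp only [hS]

variable (φ) in
/-- `h ↦ x ⊗ h`. -/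
noncomputable def create (x : X) : H →L[ℂ] PreTensor X φ :=
  LinearMap.mkContinuous (TensorProduct.mk ℂ X H x :) ‖x‖ fun h => by
    refine le_of_sq_le_sq ?_ (by positivity)
    have h1 : ((‖tmul φ x h‖ ^ 2 : ℝ) : ℂ) = ⟪h, φ (ip x x) h⟫_ℂ := by
      rw [← inner_tmul, inner_self_eq_norm_sq_to_K]
      norm_cast
    have h2 : ‖tmul φ x h‖ ^ 2 ≤ ‖x‖ ^ 2 * ‖h‖ ^ 2 := by
      calc ‖tmul φ x h‖ ^ 2 = ‖⟪h, φ (ip x x) h⟫_ℂ‖ := by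
            rw [← h1, Complex.norm_real, Real.norm_of_nonneg (by positivity)]
        _ ≤ ‖h‖ * ‖φ (ip x x) h‖ := norm_inner_le_norm _ _
        _ ≤ ‖h‖ * (‖φ (ip x x)‖ * ‖h‖) := by gcongr; exact (φ (ip x x)).le_opNorm h
        _ ≤ ‖h‖ * (‖(ip x x : B)‖ * ‖h‖) := by
            gcongr
            exact NonUnitalStarAlgHom.norm_apply_le φ _
        _ = _ := by rw [← norm_sq_eq (A := B)]; ring
    rw [mul_pow]
    exact h2

end PreTensor

end InteriorTensor

section InteriorTensor

open HilbertModule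

variable {B H : Type*} [NonUnitalCStarAlgebra B] [PartialOrder B] [StarOrderedRing B]
  [NormedAddCommGroup H] [InnerProductSpace ℂ H] [CompleteSpace H]
  (X : Type*) [NormedAddCommGroup X] [NormedSpace ℂ X] [HilbertModule B X]
  (φ : B →⋆ₙₐ[ℂ] (H →L[ℂ] H))

/-- The interior tensor product `X ⊗_B H` of a Hilbert `B`-module and a representation
`φ : B → B(H)`: the Hausdorff completion of `X ⊗ H` for the semi-inner product
`⟪x ⊗ h, y ⊗ k⟫ = ⟪h, φ(⟨x, y⟩_B) k⟫`. -/
abbrev InteriorTensor := UniformSpace.Completion (PreTensor X φ)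

namespace InteriorTensor

variable {X}

/-- The operator `h ↦ x ⊗ h` from `H` to `X ⊗_B H`. -/
noncomputable def create (x : X) : H →L[ℂ] InteriorTensor X φ :=
  (UniformSpace.Completion.toComplL : PreTensor X φ →L[ℂ] _).comp (PreTensor.create φ x)

theorem inner_create (x y : X) (h k : H) :
    ⟪create φ x h, create φ y k⟫_ℂ = ⟪h, φ (ip x y) k⟫_ℂ :=
  UniformSpace.Completion.inner_coe _ _

/-- Bounded operators on `X ⊗_B H` that agree on the elementary tensors are equal. -/
theorem hom_ext {E : Type*} [NormedAddCommGroup E] [NormedSpace ℂ E]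
    {S T : InteriorTensor X φ →L[ℂ] E} (h : ∀ x h, S (create φ x h) = T (create φ x h)) :
    S = T := by
  refine ContinuousLinearMap.ext fun t => ?_
  induction t using UniformSpace.Completion.induction_on with
  | hp => exact isClosed_eq S.continuous T.continuous
  | ih t =>
    induction t using PreTensor.induction with
    | zero => rw [UniformSpace.Completion.coe_zero, map_zero, map_zero]
    | add s t hs ht => rw [UniformSpace.Completion.coe_add, map_add, map_add, hs, ht]
    | tmul x k => exact h x k

theorem create_add (x y : X) (h : H) : create φ (x + y) h = create φ x h + create φ y h :=
  (congrArg (fun t : PreTensor X φ => (t : InteriorTensor X φ)) (TensorProduct.add_tmul x y h)).trans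
    (UniformSpace.Completion.coe_add (PreTensor.tmul φ x h) (PreTensor.tmul φ y h))

theorem create_smul (c : ℂ) (x : X) (h : H) : create φ (c • x) h = c • create φ x h :=
  UniformSpace.Completion.coe_smul c (PreTensor.tmul φ x h)

theorem create_sub (x y : X) (h : H) : create φ (x - y) h = create φ x h - create φ y h := by
  rw [eq_sub_iff_add_eq, ← create_add, sub_add_cancel]

theorem norm_create_le (x : X) (h : H) : ‖create φ x h‖ ≤ ‖x‖ * ‖h‖ := by
  refine (UniformSpace.Completion.norm_coe (PreTensor.create φ x h)).trans_le ?_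
  refine ((PreTensor.create φ x).le_opNorm h).trans ?_
  gcongr
  exact LinearMap.mkContinuous_norm_le _ (norm_nonneg _) _

/-- A vector orthogonal to the elementary tensors vanishes. -/
theorem eq_zero_of_inner_create {t : InteriorTensor X φ} (h : ∀ x k, ⟪t, create φ x k⟫_ℂ = 0) :
    t = 0 := by
  have : innerSL ℂ t = 0 := hom_ext φ fun x k => h x k
  rw [← inner_self_eq_zero (𝕜 := ℂ)]
  exact congrArg (fun S => S t) this

theorem mapLeftAux_create (T : Adjointable B X) (x : X) (h : H) :
    (PreTensor.mapLeft φ T).completion (create φ x h) = create φ (T.1 x) h :=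
  ContinuousLinearMap.completion_apply_coe _ _

/-- The representation `T ↦ T ⊗ 1` of `L(X)` on `X ⊗_B H`. -/
noncomputable def mapLeft :
    Adjointable B X →⋆ₙₐ[ℂ] (InteriorTensor X φ →L[ℂ] InteriorTensor X φ) where
  toFun T := (PreTensor.mapLeft φ T).completion
  map_smul' c T := hom_ext φ fun x h => by
    refine (mapLeftAux_create φ _ x h).trans ?_
    rw [MonoidHom.id_apply, smul_apply, mapLeftAux_create, ← create_smul]
    rfl
  map_zero' := hom_ext φ fun x h => by
    refine (mapLeftAux_create φ _ x h).trans ?_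
    exact (congrArg (create φ · h) (zero_smul ℂ x).symm).trans
      ((create_smul φ 0 x h).trans (zero_smul _ _))
  map_add' S T := hom_ext φ fun x h => by
    refine (mapLeftAux_create φ _ x h).trans ?_
    rw [add_apply, mapLeftAux_create, mapLeftAux_create, ← create_add]
    rfl
  map_mul' S T := hom_ext φ fun x h => by
    refine (mapLeftAux_create φ _ x h).trans ?_
    rw [mul_apply_eq_comp, mapLeftAux_create, mapLeftAux_create]
    rfl
  map_star' T := by
    refine hom_ext φ fun x h => ?_
    rw [mapLeftAux_create, ContinuousLinearMap.star_eq_adjoint, ← sub_eq_zero]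
    refine eq_zero_of_inner_create φ fun y k => ?_
    rw [inner_sub_left, ContinuousLinearMap.adjoint_inner_left, mapLeftAux_create, inner_create,
      inner_create, ip_apply_right, sub_self]

theorem mapLeft_create (T : Adjointable B X) (x : X) (h : H) :
    mapLeft φ T (create φ x h) = create φ (T.1 x) h :=
  mapLeftAux_create φ T x h

variable {φ}
variable {H' : Type*} [NormedAddCommGroup H'] [InnerProductSpace ℂ H'] [CompleteSpace H']
  {φ' : B →⋆ₙₐ[ℂ] (H' →L[ℂ] H')}

variable (X) in
/-- The operator `1 ⊗ S : X ⊗_B H → X ⊗_B H'`, for an operator `S : H → H'` that intertwines the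
representations of `B`. -/
noncomputable def mapRight (S : H →L[ℂ] H') (hS : ∀ b h, S (φ b h) = φ' b (S h)) :
    InteriorTensor X φ →L[ℂ] InteriorTensor X φ' :=
  (PreTensor.mapRight X S hS).completion

theorem mapRight_create (S : H →L[ℂ] H') (hS : ∀ b h, S (φ b h) = φ' b (S h)) (x : X) (h : H) :
    mapRight X S hS (create φ x h) = create φ' x (S h) :=
  ContinuousLinearMap.completion_apply_coe _ _

end InteriorTensor

end InteriorTensor

section Representations

open HilbertModule InteriorTensor

theorem inner_eq_zero_of_mem_span {E : Type*} [NormedAddCommGroup E] [InnerProductSpace ℂ E]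
    {S : Set E} {t : E} (h : ∀ s ∈ S, ⟪t, s⟫_ℂ = 0) {s : E} (hs : s ∈ Submodule.span ℂ S) :
    ⟪t, s⟫_ℂ = 0 := by
  induction hs using Submodule.span_induction with
  | mem s hs => exact h s hs
  | zero => exact inner_zero_right _
  | add s s' _ _ h h' => rw [inner_add_right, h, h', add_zero]
  | smul c s _ h => rw [inner_smul_right, h, mul_zero]

theorem dense_span_of_inner {E : Type*} [NormedAddCommGroup E] [InnerProductSpace ℂ E]
    [CompleteSpace E] {S : Set E} (h : ∀ t : E, (∀ s ∈ S, ⟪t, s⟫_ℂ = 0) → t = 0) :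
    Dense (Submodule.span ℂ S : Set E) := by
  rw [Submodule.dense_iff_topologicalClosure_eq_top, Submodule.topologicalClosure_eq_top_iff,
    Submodule.eq_bot_iff]
  exact fun t ht => h t fun s hs =>
    (Submodule.mem_orthogonal' _ _).mp ht s (Submodule.subset_span hs)

/-- A representation `Φ : V → B(H, K)` of the Hilbert `A`-module `V` on Hilbert spaces `H`, `K`,
together with the associated representation `φ : A → B(H)`: a map with
`Φ(v)⋆ Φ(w) = φ(⟨v, w⟩)` for all `v`, `w`. -/
structure ModuleRep (A V : Type u) [NonUnitalCStarAlgebra A] [PartialOrder A]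
    [NormedAddCommGroup V] [NormedSpace ℂ V] [HilbertModule A V] where
  H : Type u
  K : Type u
  [normedAddCommGroupH : NormedAddCommGroup H]
  [innerProductSpaceH : InnerProductSpace ℂ H]
  [completeSpaceH : CompleteSpace H]
  [normedAddCommGroupK : NormedAddCommGroup K]
  [innerProductSpaceK : InnerProductSpace ℂ K]
  [completeSpaceK : CompleteSpace K]
  φ : A →⋆ₙₐ[ℂ] (H →L[ℂ] H)
  Φ : V → (H →L[ℂ] K)
  adjoint_comp : ∀ v w, (ContinuousLinearMap.adjoint (Φ v)).comp (Φ w) = φ (ip v w)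

attribute [instance] ModuleRep.normedAddCommGroupH ModuleRep.innerProductSpaceH
  ModuleRep.completeSpaceH ModuleRep.normedAddCommGroupK ModuleRep.innerProductSpaceK
  ModuleRep.completeSpaceK

namespace ModuleRep

section

variable {A V : Type u} [NonUnitalCStarAlgebra A] [PartialOrder A]
  [NormedAddCommGroup V] [NormedSpace ℂ V] [HilbertModule A V]

/-- `Φ` is non-degenerate if `Φ(V) H` spans a dense subspace of `K` and `Φ(V)⋆ K` spans a dense
subspace of `H`. -/
structure IsNondegenerate (π : ModuleRep A V) : Prop where
  dense_map : Dense (Submodule.span ℂ {k : π.K | ∃ v h, π.Φ v h = k} : Set π.K)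
  dense_adjoint : Dense (Submodule.span ℂ
    {h : π.H | ∃ v k, ContinuousLinearMap.adjoint (π.Φ v) k = h} : Set π.H)

/-- Two representations are unitarily equivalent if there are unitaries `U₁`, `U₂` with
`U₂ Φ(v) = Φ'(v) U₁` for all `v`. -/
def UnitarilyEquivalent (π ρ : ModuleRep A V) : Prop :=
  ∃ (U₁ : π.H ≃ₗᵢ[ℂ] ρ.H) (U₂ : π.K ≃ₗᵢ[ℂ] ρ.K), ∀ v h, U₂ (π.Φ v h) = ρ.Φ v (U₁ h)

variable (π : ModuleRep A V)

theorem inner_map_map (v w : V) (h k : π.H) :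
    ⟪π.Φ v h, π.Φ w k⟫_ℂ = ⟪h, π.φ (ip v w) k⟫_ℂ := by
  rw [← π.adjoint_comp, ContinuousLinearMap.comp_apply, ContinuousLinearMap.adjoint_inner_right]

theorem map_rsmul (v : V) (a : A) (h : π.H) : π.Φ (rsmul v a) h = π.Φ v (π.φ a h) := by
  have hm : ∀ b c, π.φ b (π.φ c h) = π.φ (b * c) h := fun b c => by rw [map_mul]; rfl
  have hs : ∀ b k, ⟪π.φ a h, π.φ b k⟫_ℂ = ⟪h, π.φ (star a * b) k⟫_ℂ := fun b k => by
    rw [map_mul, map_star, ContinuousLinearMap.star_eq_adjoint, mul_apply_eq_comp,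
      ContinuousLinearMap.adjoint_inner_right]
  rw [← sub_eq_zero, ← inner_self_eq_zero (𝕜 := ℂ)]
  simp only [inner_sub_left, inner_sub_right, inner_map_map, hs, hm, ip_rsmul_left,
    ip_rsmul_right, mul_assoc, sub_self]

variable {π}

theorem eq_zero_of_map_eq_zero (hπ : π.IsNondegenerate) {h : π.H} (h0 : ∀ v, π.Φ v h = 0) :
    h = 0 := by
  refine hπ.dense_adjoint.eq_zero_of_inner_left (𝕜 := ℂ) fun x hx => ?_
  refine inner_eq_zero_of_mem_span ?_ hx
  rintro _ ⟨v, k, rfl⟩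
  rw [ContinuousLinearMap.adjoint_inner_right, h0, inner_zero_left]

end

section Induced

variable {A B W : Type u} [NonUnitalCStarAlgebra A] [PartialOrder A] [StarOrderedRing A]
  [NonUnitalCStarAlgebra B] [PartialOrder B] [StarOrderedRing B]
  (V : Type u) [NormedAddCommGroup V] [NormedSpace ℂ V] [HilbertModule A V]
  [NormedAddCommGroup W] [NormedSpace ℂ W] [HilbertModule B W]
  (X : ImprimitivityBimodule A B)

/-- The induced representation `Ind_X φ : A → B(X ⊗_B H)`, `a ↦ (x ⊗ h ↦ a x ⊗ h)`, of `A`. -/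
noncomputable def indAlg {H : Type u} [NormedAddCommGroup H] [InnerProductSpace ℂ H]
    [CompleteSpace H] (φ : B →⋆ₙₐ[ℂ] (H →L[ℂ] H)) :
    A →⋆ₙₐ[ℂ] (InteriorTensor X.carrier φ →L[ℂ] InteriorTensor X.carrier φ) :=
  (mapLeft φ).comp X.leftAction

theorem indAlg_create {H : Type u} [NormedAddCommGroup H] [InnerProductSpace ℂ H]
    [CompleteSpace H] (φ : B →⋆ₙₐ[ℂ] (H →L[ℂ] H)) (a : A) (x : X.carrier) (h : H) :
    indAlg X φ a (create φ x h) = create φ (X.lsmul a x) h :=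
  mapLeft_create φ _ x h

/-- `Ind_X φ` is non-degenerate. -/
theorem eq_zero_of_indAlg {H : Type u} [NormedAddCommGroup H] [InnerProductSpace ℂ H]
    [CompleteSpace H] (φ : B →⋆ₙₐ[ℂ] (H →L[ℂ] H)) {t : InteriorTensor X.carrier φ}
    (h2 : ∀ a : A, indAlg X φ a t = 0) : t = 0 := by
  have h3 : ∀ (a : A) (x : X.carrier) (h : H), ⟪t, create φ (X.lsmul a x) h⟫_ℂ = 0 :=
    fun a x h => by
      have : star (indAlg X φ (star a)) = indAlg X φ a := by rw [← map_star, star_star]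
      rw [← indAlg_create, ← this, ContinuousLinearMap.star_eq_adjoint,
        ContinuousLinearMap.adjoint_inner_right, h2, inner_zero_left]
  refine eq_zero_of_inner_create _ fun x h => ?_
  have h4 : Filter.Tendsto (fun a : A => ⟪t, create φ (X.lsmul a x) h⟫_ℂ)
      (CStarAlgebra.approximateUnit A) (nhds ⟪t, create φ x h⟫_ℂ) := by
    refine tendsto_const_nhds.inner ?_
    rw [tendsto_iff_norm_sub_tendsto_zero]
    refine squeeze_zero (fun _ => norm_nonneg _)
      (fun a => (congrArg norm (create_sub φ (X.lsmul a x) x h)).symm.trans_le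
        (norm_create_le φ _ _)) ?_
    simpa using (tendsto_iff_norm_sub_tendsto_zero.mp (X.tendsto_lsmul x)).mul_const ‖h‖
  exact (tendsto_nhds_unique h4 (by simp only [h3]; exact tendsto_const_nhds))

/-- The induced representation `Ind_X Φ : V → B(X ⊗_B H, V ⊗_A (X ⊗_B H))`,
`Ind_X Φ(v) (x ⊗ h) = v ⊗ x ⊗ h`, of the Hilbert `A`-module `V`. -/
noncomputable def ind (π : ModuleRep B W) : ModuleRep A V where
  H := InteriorTensor X.carrier π.φ
  K := InteriorTensor V (indAlg X π.φ)
  φ := indAlg X π.φ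
  Φ v := create (indAlg X π.φ) v
  adjoint_comp v w := ContinuousLinearMap.ext fun s => ext_inner_left ℂ fun t => by
    rw [ContinuousLinearMap.comp_apply, ContinuousLinearMap.adjoint_inner_right, inner_create]

variable {V}

theorem ind_isNondegenerate (hV : IsFull A V) (π : ModuleRep B W) :
    (ind V X π).IsNondegenerate where
  dense_map := dense_span_of_inner fun t ht =>
    eq_zero_of_inner_create _ fun v k => ht _ ⟨v, k, rfl⟩
  dense_adjoint := dense_span_of_inner fun t ht => by
    have h1 : ∀ v, (ind V X π).Φ v t = 0 := fun v => by
      rw [← inner_self_eq_zero (𝕜 := ℂ), ← ContinuousLinearMap.adjoint_inner_right]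
      exact ht _ ⟨v, _, rfl⟩
    have h2 : ∀ a : A, (ind V X π).φ a t = 0 := by
      have hc : IsClosed {a : A | (ind V X π).φ a t = 0} := by
        have : Continuous (ind V X π).φ := map_continuous (ind V X π).φ
        exact isClosed_eq (by fun_prop) continuous_const
      have hs : (Submodule.span ℂ {a : A | ∃ v w : V, ip v w = a} : Set A) ⊆
          {a : A | (ind V X π).φ a t = 0} := by
        intro a ha
        induction ha using Submodule.span_induction with
        | mem a h =>
          obtain ⟨v, w, rfl⟩ := h
          change (ind V X π).φ (ip v w) t = 0
          rw [← adjoint_comp, ContinuousLinearMap.comp_apply, h1, map_zero]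
        | zero => exact congrArg (fun S => S t) (map_zero (ind V X π).φ)
        | add a b _ _ h h' =>
          refine (congrArg (fun S => S t) (map_add (ind V X π).φ a b)).trans ?_
          exact (congrArg₂ (· + ·) h h').trans (add_zero _)
        | smul c a _ h =>
          refine (congrArg (fun S => S t) (map_smul (ind V X π).φ c a)).trans ?_
          exact (congrArg (c • ·) h).trans (smul_zero _)
      exact fun a => hc.closure_subset_iff.mpr hs (hV a)
    exact eq_zero_of_indAlg X π.φ h2

end Induced

end ModuleRep

/-- The non-degenerate representations of the Hilbert `A`-module `V`. -/
structure NondegRep (A V : Type u) [NonUnitalCStarAlgebra A] [PartialOrder A]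
    [NormedAddCommGroup V] [NormedSpace ℂ V] [HilbertModule A V] extends ModuleRep A V where
  nondeg : toModuleRep.IsNondegenerate

namespace NondegRep

open CategoryTheory

section

variable {A V : Type u} [NonUnitalCStarAlgebra A] [PartialOrder A]
  [NormedAddCommGroup V] [NormedSpace ℂ V] [HilbertModule A V]

/-- A morphism from `Φ : V → B(H, K)` to `Φ' : V → B(H', K')`: bounded operators `T : H → H'` and
`S : K → K'` with `S Φ(v) = Φ'(v) T` for all `v`.  As `Φ'` is non-degenerate, `T` intertwines `φ`
and `φ'`, see `NondegRep.Hom.fst_φ`. -/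
@[ext]
structure Hom (π ρ : NondegRep A V) where
  fst : π.H →L[ℂ] ρ.H
  snd : π.K →L[ℂ] ρ.K
  comm : ∀ v h, snd (π.Φ v h) = ρ.Φ v (fst h)

/-- The category of non-degenerate representations of `V`. -/
instance : Category.{u} (NondegRep A V) where
  Hom := Hom
  id π := ⟨ContinuousLinearMap.id ℂ _, ContinuousLinearMap.id ℂ _, fun _ _ => rfl⟩
  comp f g := ⟨g.fst.comp f.fst, g.snd.comp f.snd, fun v h => by
    simp only [ContinuousLinearMap.comp_apply, f.comm, g.comm]⟩

/-- A morphism of representations is unitary if both of its operators are; two representations are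
unitarily equivalent exactly when there is a unitary morphism between them. -/
def IsUnitary {π ρ : NondegRep A V} (f : π ⟶ ρ) : Prop :=
  (∃ U₁ : π.H ≃ₗᵢ[ℂ] ρ.H, ∀ h, U₁ h = f.fst h) ∧ ∃ U₂ : π.K ≃ₗᵢ[ℂ] ρ.K, ∀ k, U₂ k = f.snd k

theorem unitarilyEquivalent_iff (π ρ : NondegRep A V) :
    π.UnitarilyEquivalent ρ.toModuleRep ↔ ∃ f : π ⟶ ρ, IsUnitary f := by
  constructor
  · rintro ⟨U₁, U₂, h⟩
    exact ⟨⟨U₁.toContinuousLinearEquiv, U₂.toContinuousLinearEquiv, h⟩, ⟨U₁, fun _ => rfl⟩,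
      U₂, fun _ => rfl⟩
  · rintro ⟨f, ⟨U₁, h₁⟩, U₂, h₂⟩
    refine ⟨U₁, U₂, fun v h => ?_⟩
    rw [h₁, h₂, f.comm]

theorem Hom.fst_φ {π ρ : NondegRep A V} (f : π.Hom ρ) (a : A) (h : π.H) :
    f.fst (π.φ a h) = ρ.φ a (f.fst h) := by
  rw [← sub_eq_zero]
  refine ModuleRep.eq_zero_of_map_eq_zero ρ.nondeg fun v => ?_
  rw [map_sub, ← f.comm, ← π.map_rsmul, ← ρ.map_rsmul, f.comm, sub_self]

end

section Induced

variable {A B V W : Type u} [NonUnitalCStarAlgebra A] [PartialOrder A] [StarOrderedRing A]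
  [NonUnitalCStarAlgebra B] [PartialOrder B] [StarOrderedRing B]
  [NormedAddCommGroup V] [NormedSpace ℂ V] [HilbertModule A V]
  [NormedAddCommGroup W] [NormedSpace ℂ W] [HilbertModule B W]

theorem mapRight_indAlg (X : ImprimitivityBimodule A B) {π ρ : NondegRep B W} (f : π.Hom ρ)
    (a : A) (t : InteriorTensor X.carrier π.φ) :
    mapRight X.carrier f.fst f.fst_φ (ModuleRep.indAlg X π.φ a t) =
      ModuleRep.indAlg X ρ.φ a (mapRight X.carrier f.fst f.fst_φ t) := by
  have : (mapRight X.carrier f.fst f.fst_φ).comp (ModuleRep.indAlg X π.φ a) =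
      (ModuleRep.indAlg X ρ.φ a).comp (mapRight X.carrier f.fst f.fst_φ) :=
    hom_ext _ fun x h => by
      simp only [ContinuousLinearMap.comp_apply, ModuleRep.indAlg_create, mapRight_create]
  exact congrArg (fun S => S t) this

/-- Rieffel induction from `W` to `V` via `X`, as a functor between the categories of
non-degenerate representations: `Φ` is sent to `Ind_X Φ` and `(T, S)` to `(1 ⊗ T, 1 ⊗ 1 ⊗ T)`. -/
noncomputable def ind (hV : IsFull A V) (X : ImprimitivityBimodule A B) :
    NondegRep B W ⥤ NondegRep A V where
  obj π := ⟨ModuleRep.ind V X π.toModuleRep, ModuleRep.ind_isNondegenerate X hV _⟩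
  map {π ρ} f :=
    { fst := mapRight X.carrier f.fst f.fst_φ
      snd := mapRight V (mapRight X.carrier f.fst f.fst_φ) (mapRight_indAlg X f)
      comm := fun v t => mapRight_create _ _ v t }
  map_id π := by
    have h1 : mapRight X.carrier (𝟙 π : π.Hom π).fst (𝟙 π : π.Hom π).fst_φ =
        ContinuousLinearMap.id ℂ _ := hom_ext _ fun x h => mapRight_create _ _ x h
    refine Hom.ext h1 (hom_ext _ fun v t => ?_)
    refine (mapRight_create _ _ v t).trans ?_
    rw [h1]
    rfl
  map_comp {π ρ σ} f g := by
    have h1 : mapRight X.carrier (f ≫ g : π.Hom σ).fst (f ≫ g : π.Hom σ).fst_φ =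
        (mapRight X.carrier g.fst g.fst_φ).comp (mapRight X.carrier f.fst f.fst_φ) :=
      hom_ext _ fun x h => by
        rw [ContinuousLinearMap.comp_apply, mapRight_create, mapRight_create, mapRight_create]
        rfl
    refine Hom.ext h1 (hom_ext _ fun v t => ?_)
    refine (mapRight_create _ _ v t).trans ?_
    rw [h1]
    exact ((congrArg _ (mapRight_create _ (mapRight_indAlg X f) v t)).trans
      (mapRight_create _ (mapRight_indAlg X g) v _)).symm

end Induced

end NondegRep

/-- Hilbert modules `V`, `W` are Morita equivalent, in the sense of Joita and Moslehian, if the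
`C⋆`-algebras `K(V)` and `K(W)` of compact operators are. -/
def HilbertModule.MoritaEquivalent (A V B W : Type u)
    [NonUnitalCStarAlgebra A] [PartialOrder A] [StarOrderedRing A]
    [NonUnitalCStarAlgebra B] [PartialOrder B] [StarOrderedRing B]
    [NormedAddCommGroup V] [NormedSpace ℂ V] [HilbertModule A V]
    [NormedAddCommGroup W] [NormedSpace ℂ W] [HilbertModule B W] : Prop :=
  _root_.MoritaEquivalent (CompactOperators A V) (CompactOperators B W)

end Representations

/-! ### Unitaries from total families with equal Gram matrices -/

section TotalFamilies

variable {ι E F : Type*} [NormedAddCommGroup E] [InnerProductSpace ℂ E] [CompleteSpace E]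
  [NormedAddCommGroup F] [InnerProductSpace ℂ F] [CompleteSpace F]

/-! A non-degenerate representation `Φ` of a Hilbert `A`-module is determined, up to unitary
equivalence, by the representation `φ` of `A` on `H`. Indeed `K` is the closed span of the vectors
`Φ(v) h`, and their Gram matrix `⟪h, φ(⟨v, w⟩) k⟫` involves only `φ`. Hence a morphism is determined
by its first component, and every unitary that intertwines the representations of `A` extends to a
unitary morphism (`hom_ext_fst`, `exists_isUnitary`). All questions about `V` and `W` thus become
questions about Rieffel induction for `A` and `B`.

For the algebras, the unitary from `X̃ ⊗_A X ⊗_B H` to `H` is `♭(x) ⊗ y ⊗ h ↦ φ(⟨x, y⟩_B) h`. It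
preserves inner products because `_A⟨x, x'⟩ y' = x ⟨x', y'⟩_B`. Its range is dense because `X` is
full over `B` and `φ` is non-degenerate. It is natural because morphisms intertwine the
representations of `B` (`exists_isUnitary_ind_ind`, `exists_natIso_ind_ind`). The other composite is
the same statement for `X̃`, whose dual is identified with `X`. The unitaries are all obtained from
one principle: two total families with equal Gram matrices are carried into each other by a unitary
(`exists_unitary_of_total`).

For Morita equivalent modules, the given bimodule connects only `K(V)` and `K(W)`. A full Hilbert
`A`-module `V` is itself a `K(V)`–`A`-imprimitivity bimodule (`ofFull`), the delicate axiom being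
the positivity of `θ_{v,v}` in `K(V)`. Three inductions, along `W`, the given bimodule and `V`, then
compose to the required equivalence. -/

theorem denseRange_linearCombination_of_inner {e : ι → E}
    (he : ∀ t, (∀ i, ⟪t, e i⟫_ℂ = 0) → t = 0) :
    DenseRange (Finsupp.linearCombination ℂ e) := by
  have h := dense_span_of_inner (S := Set.range e) fun t ht => he t fun i => ht _ ⟨i, rfl⟩
  rw [← Finsupp.range_linearCombination] at h
  exact h

/-- Total families of two Hilbert spaces with equal Gram matrices are unitarily equivalent. -/
theorem exists_unitary_of_total {e : ι → E} {f : ι → F}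
    (he : ∀ t, (∀ i, ⟪t, e i⟫_ℂ = 0) → t = 0) (hf : ∀ t, (∀ i, ⟪t, f i⟫_ℂ = 0) → t = 0)
    (hef : ∀ i j, ⟪e i, e j⟫_ℂ = ⟪f i, f j⟫_ℂ) :
    ∃ U : E ≃ₗᵢ[ℂ] F, ∀ i, U (e i) = f i := by
  -- The free space on `ι` maps onto dense subspaces of both `E` and `F`. Equal Gram matrices make
  -- the identity of the free space isometric for the two induced seminorms, so it extends to a
  -- unitary.
  refine ⟨(LinearEquiv.refl ℂ (ι →₀ ℂ)).extendOfIsometry (Finsupp.linearCombination ℂ e)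
    (Finsupp.linearCombination ℂ f) (denseRange_linearCombination_of_inner he)
    (denseRange_linearCombination_of_inner hf) fun c => ?_, fun i => ?_⟩
  · have h : ⟪Finsupp.linearCombination ℂ f c, Finsupp.linearCombination ℂ f c⟫_ℂ =
        ⟪Finsupp.linearCombination ℂ e c, Finsupp.linearCombination ℂ e c⟫_ℂ := by
      simp only [Finsupp.linearCombination_apply, Finsupp.sum, sum_inner, inner_sum,
        inner_smul_left, inner_smul_right, hef]
    rw [LinearEquiv.refl_apply, norm_eq_sqrt_re_inner (𝕜 := ℂ), h,
      ← norm_eq_sqrt_re_inner (𝕜 := ℂ)]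
  · have := LinearEquiv.extendOfIsometry_eq (LinearEquiv.refl ℂ (ι →₀ ℂ))
      (Finsupp.linearCombination ℂ e) (Finsupp.linearCombination ℂ f)
      (denseRange_linearCombination_of_inner he)
      (denseRange_linearCombination_of_inner hf) ?_ (Finsupp.single i 1)
    simpa using this

end TotalFamilies

/-! ### Vectors detected by a non-degenerate representation -/

namespace ModuleRep

open HilbertModule

variable {A V : Type u} [NonUnitalCStarAlgebra A] [PartialOrder A]
  [NormedAddCommGroup V] [NormedSpace ℂ V] [HilbertModule A V]

theorem eq_zero_of_inner_map {π : ModuleRep A V} (hπ : π.IsNondegenerate) {k : π.K}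
    (h0 : ∀ v h, ⟪k, π.Φ v h⟫_ℂ = 0) : k = 0 := by
  refine hπ.dense_map.eq_zero_of_inner_left (𝕜 := ℂ) fun x hx => ?_
  refine inner_eq_zero_of_mem_span ?_ hx
  rintro _ ⟨v, h, rfl⟩
  exact h0 v h

/-- The representation of `A` associated with a non-degenerate representation is
non-degenerate. -/
theorem eq_zero_of_inner_φ {π : ModuleRep A V} (hπ : π.IsNondegenerate) {t : π.H}
    (h0 : ∀ a h, ⟪t, π.φ a h⟫_ℂ = 0) : t = 0 := by
  refine eq_zero_of_map_eq_zero hπ fun v => ?_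
  -- `‖Φ(v) t‖² = ⟪t, φ(⟨v, v⟩) t⟫`, which vanishes by assumption.
  rw [← inner_self_eq_zero (𝕜 := ℂ), inner_map_map]
  exact h0 _ _

end ModuleRep

/-! ### Unitary morphisms are governed by their first component -/

namespace NondegRep

open CategoryTheory HilbertModule

section

variable {A V : Type u} [NonUnitalCStarAlgebra A] [PartialOrder A]
  [NormedAddCommGroup V] [NormedSpace ℂ V] [HilbertModule A V]

/-- A morphism of non-degenerate representations is determined by its first component. -/
theorem hom_ext_fst {π ρ : NondegRep A V} {f g : π ⟶ ρ} (h : ∀ x, f.fst x = g.fst x) :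
    f = g := by
  refine Hom.ext (ContinuousLinearMap.ext h) ?_
  -- The relation `S Φ(v) = Φ'(v) T` prescribes `S` on the total set `Φ(V) H`.
  refine ContinuousLinearMap.ext_on π.nondeg.dense_map ?_
  rintro _ ⟨v, x, rfl⟩
  rw [f.comm, g.comm, h]

/-- A unitary that intertwines the representations of `A` is the first component of a unitary
morphism of representations of `V`. -/
theorem exists_isUnitary {π ρ : NondegRep A V} (U : π.H ≃ₗᵢ[ℂ] ρ.H)
    (hU : ∀ a h, U (π.φ a h) = ρ.φ a (U h)) :
    ∃ f : π ⟶ ρ, IsUnitary f ∧ ∀ h, f.fst h = U h := by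
  -- The second component must send `Φ(v) h` to `Φ'(v) U h`. Both families are total, and their Gram
  -- matrices are expressed through the representations of `A`, which `U` intertwines.
  obtain ⟨U₂, hU₂⟩ := exists_unitary_of_total (ι := V × π.H)
    (e := fun p => π.Φ p.1 p.2) (f := fun p => ρ.Φ p.1 (U p.2))
    (fun t ht => ModuleRep.eq_zero_of_inner_map π.nondeg fun v h => ht (v, h))
    (fun t ht => ModuleRep.eq_zero_of_inner_map ρ.nondeg fun v h => by
      simpa using ht (v, U.symm h))
    (fun p q => by
      rw [ModuleRep.inner_map_map, ModuleRep.inner_map_map, ← hU, U.inner_map_map])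
  exact ⟨⟨U.toContinuousLinearEquiv, U₂.toContinuousLinearEquiv, fun v h => hU₂ (v, h)⟩,
    ⟨⟨U, fun _ => rfl⟩, U₂, fun _ => rfl⟩, fun _ => rfl⟩

/-- A morphism of non-degenerate representations is unitary if its first component is. -/
theorem isUnitary_of_fst {π ρ : NondegRep A V} {f : π ⟶ ρ} (U : π.H ≃ₗᵢ[ℂ] ρ.H)
    (hU : ∀ h, U h = f.fst h) : IsUnitary f := by
  -- The unitary morphism built from `U` has the same first component as `f`, so it is `f`; the
  -- second component needs no separate check.
  obtain ⟨g, hg, h⟩ := exists_isUnitary U fun a x => by rw [hU, hU, Hom.fst_φ]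
  rwa [hom_ext_fst (f := f) (g := g) fun x => by rw [h, hU]]

theorem isUnitary_comp {π ρ σ : NondegRep A V} {f : π ⟶ ρ} {g : ρ ⟶ σ} (hf : IsUnitary f)
    (hg : IsUnitary g) : IsUnitary (f ≫ g) := by
  obtain ⟨⟨U, hU⟩, -⟩ := hf
  obtain ⟨⟨U', hU'⟩, -⟩ := hg
  exact isUnitary_of_fst (U.trans U') fun h =>
    (congrArg U' (hU h)).trans (hU' _)

/-- A unitary morphism has a unitary inverse. -/
theorem IsUnitary.exists_inverse {π ρ : NondegRep A V} {f : π ⟶ ρ} (hf : IsUnitary f) :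
    ∃ g : ρ ⟶ π, IsUnitary g ∧ f ≫ g = 𝟙 π ∧ g ≫ f = 𝟙 ρ := by
  obtain ⟨⟨U, hU⟩, -⟩ := hf
  obtain ⟨g, hg, h⟩ := exists_isUnitary U.symm fun a x => by
    rw [LinearIsometryEquiv.symm_apply_eq, hU, Hom.fst_φ, ← hU, U.apply_symm_apply]
  refine ⟨g, hg, hom_ext_fst fun x => ?_, hom_ext_fst fun x => ?_⟩
  · exact (h _).trans ((congrArg U.symm (hU x).symm).trans (U.symm_apply_apply x))
  · exact (hU _).symm.trans ((congrArg U (h x)).trans (U.apply_symm_apply x))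

theorem IsUnitary.isIso {π ρ : NondegRep A V} {f : π ⟶ ρ} (hf : IsUnitary f) : IsIso f := by
  obtain ⟨g, -, h, h'⟩ := hf.exists_inverse
  exact ⟨g, h, h'⟩

/-- A one-sided inverse is enough, since a unitary `f` already has a two-sided unitary inverse and
`g` must coincide with it. -/
theorem isUnitary_inv {π ρ : NondegRep A V} {f : π ⟶ ρ} {g : ρ ⟶ π} (hf : IsUnitary f)
    (hfg : f ≫ g = 𝟙 π) : IsUnitary g := by
  obtain ⟨g', hg', -, h'⟩ := hf.exists_inverse
  have : g' = g := by rw [← Category.comp_id g', ← hfg, ← Category.assoc, h', Category.id_comp]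
  rwa [← this]

end

/-! ### Rieffel induction along a bimodule and along its dual -/

section Induced

open InteriorTensor

variable {A B V W : Type u} [NonUnitalCStarAlgebra A] [PartialOrder A] [StarOrderedRing A]
  [NonUnitalCStarAlgebra B] [PartialOrder B] [StarOrderedRing B]
  [NormedAddCommGroup V] [NormedSpace ℂ V] [HilbertModule A V]
  [NormedAddCommGroup W] [NormedSpace ℂ W] [HilbertModule B W]

/-- Rieffel induction sends unitary morphisms to unitary morphisms. -/
theorem isUnitary_ind_map (hV : IsFull A V) (X : ImprimitivityBimodule A B)
    {π ρ : NondegRep B W} {f : π ⟶ ρ} (hf : IsUnitary f) :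
    IsUnitary ((ind hV X).map f) := by
  obtain ⟨⟨U, hU⟩, -⟩ := hf
  -- `U'` is `1 ⊗ U`. It is compared below with the first component of the induced morphism on
  -- elementary tensors, after which `isUnitary_of_fst` takes care of the second component.
  obtain ⟨U', hU'⟩ := exists_unitary_of_total (ι := X.carrier × π.H)
    (e := fun p => create π.φ p.1 p.2) (f := fun p => create ρ.φ p.1 (U p.2))
    (fun t ht => eq_zero_of_inner_create _ fun x h => ht (x, h))
    (fun t ht => eq_zero_of_inner_create _ fun x h => by simpa using ht (x, U.symm h))
    (fun p q => by
      rw [inner_create, inner_create, hU q.2, ← Hom.fst_φ, ← hU, U.inner_map_map])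
  have h : (U'.toContinuousLinearEquiv : _ →L[ℂ] InteriorTensor X.carrier ρ.φ) =
      mapRight X.carrier f.fst (Hom.fst_φ f) :=
    InteriorTensor.hom_ext _ fun x h => by
      rw [mapRight_create, ← hU]
      exact hU' (x, h)
  exact isUnitary_of_fst U' fun t => congrArg (fun S => S t) h

/-- If `♭ : X → Y` identifies the `B`–`A`-imprimitivity bimodule `Y` with the dual of `X`, then
`♭(x) ⊗ y ⊗ h ↦ φ(⟨x, y⟩_B) h` is a unitary `Ind_Y (Ind_X Φ) → Φ`. -/
theorem exists_isUnitary_ind_ind (hV : IsFull A V) (hW : IsFull B W)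
    (X : ImprimitivityBimodule A B) (Y : ImprimitivityBimodule B A) (flat : X.carrier → Y.carrier)
    (hs : Function.Surjective flat)
    (hip : ∀ x y, (ip (flat x) (flat y) : A) = X.lip x y)
    (hsmul : ∀ b x, Y.lsmul b (flat x) = flat (rsmul x (star b))) (π : NondegRep B W) :
    ∃ f : (ind hW Y).obj ((ind hV X).obj π : NondegRep A V) ⟶ π, IsUnitary f ∧
      ∀ x y h, f.fst (create (ModuleRep.indAlg X π.φ) (flat x) (create π.φ y h)) =
        π.φ (ip x y) h := by
  have hm : ∀ b c h, π.φ b (π.φ c h) = π.φ (b * c) h := fun b c h => by rw [map_mul]; rfl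
  have hstar : ∀ b h k, ⟪π.φ b h, k⟫_ℂ = ⟪h, π.φ (star b) k⟫_ℂ := fun b h k => by
    rw [map_star, ContinuousLinearMap.star_eq_adjoint, ContinuousLinearMap.adjoint_inner_right]
  obtain ⟨U, hU⟩ := exists_unitary_of_total (ι := X.carrier × X.carrier × π.H)
    (e := fun p => create (ModuleRep.indAlg X π.φ) (flat p.1) (create π.φ p.2.1 p.2.2))
    (f := fun p => π.φ (ip p.1 p.2.1) p.2.2)
    -- The vectors `♭(x) ⊗ y ⊗ h` are total: it suffices to test against `♭(x) ⊗ s`, and for fixed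
    -- `x` the bounded functional `s ↦ ⟪t, ♭(x) ⊗ s⟫` is determined by the elementary tensors `s = y
    -- ⊗ h`.
    (fun t ht => eq_zero_of_inner_create _ fun y => by
      obtain ⟨x, rfl⟩ := hs y
      have : (innerSL ℂ t).comp (create (ModuleRep.indAlg X π.φ) (flat x)) = 0 :=
        InteriorTensor.hom_ext _ fun y h => ht (x, y, h)
      exact fun k => congrArg (fun S => S k) this)
    -- The elements `b` with `⟪t, φ(b) h⟫ = 0` form a closed subspace containing every `⟨x, y⟩_B`,
    -- hence all of `B` by fullness of `X`; non-degeneracy of `φ` then gives `t = 0`.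
    (fun t ht => ModuleRep.eq_zero_of_inner_φ π.nondeg fun b h => by
      have hc : IsClosed {b : B | ⟪t, π.φ b h⟫_ℂ = 0} := by
        have : Continuous π.φ := map_continuous π.φ
        exact isClosed_eq (by fun_prop) continuous_const
      refine hc.closure_subset_iff.mpr (fun b hb => ?_) (X.full_right b)
      induction hb using Submodule.span_induction with
      | mem b hb =>
        obtain ⟨x, y, rfl⟩ := hb
        exact ht (x, y, h)
      | zero => simp
      | add b c _ _ hb hc =>
        simp only [Set.mem_ofPred_eq] at hb hc ⊢
        rw [map_add, add_apply, inner_add_right, hb, hc, add_zero]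
      | smul c b _ hb =>
        simp only [Set.mem_ofPred_eq] at hb ⊢
        rw [map_smul, smul_apply, inner_smul_right, hb, mul_zero])
    -- Both Gram matrices equal `⟪h, φ(⟨y, x⟩_B ⟨x', y'⟩_B) k⟫`; on the side of the tensors this
    -- uses `_A⟨x, x'⟩ y' = x ⟨x', y'⟩_B`.
    (fun p q => by
      rw [inner_create, hip, ModuleRep.indAlg_create, inner_create, X.lip_lsmul, ip_rsmul_right,
        hstar, hm, star_ip])
  obtain ⟨f, hf, hfU⟩ := exists_isUnitary
    (π := (ind hW Y).obj ((ind hV X).obj π : NondegRep A V)) (ρ := π) U fun b t => by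
      have : (U.toContinuousLinearEquiv : _ →L[ℂ] π.H).comp
          (ModuleRep.indAlg Y (ModuleRep.indAlg X π.φ) b) =
          (π.φ b).comp (U.toContinuousLinearEquiv : _ →L[ℂ] π.H) := by
        refine InteriorTensor.hom_ext _ fun y => ?_
        obtain ⟨x, rfl⟩ := hs y
        refine fun k => ?_
        rw [ContinuousLinearMap.comp_apply, ContinuousLinearMap.comp_apply,
          ModuleRep.indAlg_create, hsmul]
        have : ((U.toContinuousLinearEquiv : _ →L[ℂ] π.H)).comp
            (create (ModuleRep.indAlg X π.φ) (flat (rsmul x (star b)))) =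
            (π.φ b).comp ((U.toContinuousLinearEquiv : _ →L[ℂ] π.H).comp
              (create (ModuleRep.indAlg X π.φ) (flat x))) :=
          InteriorTensor.hom_ext _ fun y h => by
            refine (hU (rsmul x (star b), y, h)).trans ?_
            refine Eq.trans ?_ (congrArg (π.φ b) (hU (x, y, h))).symm
            -- `U` intertwines the actions of `B` because `b ♭(x) = ♭(x b⋆)` and `⟨x b⋆, y⟩_B = b
            -- ⟨x, y⟩_B`.
            rw [hm, ip_rsmul_left, star_star]
        exact congrArg (fun S => S k) this
      exact congrArg (fun S => S t) this
  exact ⟨f, hf, fun x y h => (hfU _).trans (hU (x, y, h))⟩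

/-- The explicit formula for the unitaries gives naturality: a morphism `(T, S)` satisfies `T φ(⟨x,
y⟩_B) h = φ'(⟨x, y⟩_B) T h`. Working with an abstract `Y` and `♭` instead of `X.dual` lets the same
statement serve both composites, without comparing `X` with its double dual. -/
theorem exists_natIso_ind_ind (hV : IsFull A V) (hW : IsFull B W)
    (X : ImprimitivityBimodule A B) (Y : ImprimitivityBimodule B A) (flat : X.carrier → Y.carrier)
    (hs : Function.Surjective flat)
    (hip : ∀ x y, (ip (flat x) (flat y) : A) = X.lip x y)
    (hsmul : ∀ b x, Y.lsmul b (flat x) = flat (rsmul x (star b))) :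
    ∃ α : (ind hV X : NondegRep B W ⥤ NondegRep A V) ⋙ ind hW Y ≅ 𝟭 (NondegRep B W),
      ∀ π, IsUnitary (α.hom.app π) := by
  choose f hf hfU using exists_isUnitary_ind_ind hV hW X Y flat hs hip hsmul
  refine ⟨NatIso.ofComponents (fun π => @asIso _ _ _ _ (f π) (hf π).isIso)
    fun {π ρ} g => hom_ext_fst fun t => ?_, hf⟩
  have h : (f ρ).fst.comp ((ind hW Y).map ((ind hV X : NondegRep B W ⥤ NondegRep A V).map g)).fst =
      (Hom.fst g).comp (f π).fst := by
    refine InteriorTensor.hom_ext _ fun y => ?_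
    obtain ⟨x, rfl⟩ := hs y
    refine fun k => ?_
    have : ((f ρ).fst.comp
        ((ind hW Y).map ((ind hV X : NondegRep B W ⥤ NondegRep A V).map g)).fst).comp
        (create (ModuleRep.indAlg X π.φ) (flat x)) = ((Hom.fst g).comp (f π).fst).comp
        (create (ModuleRep.indAlg X π.φ) (flat x)) := by
      refine InteriorTensor.hom_ext _ fun y h => ?_
      have h1 : ((ind hW Y).map ((ind hV X : NondegRep B W ⥤ NondegRep A V).map g)).fst
          (create (ModuleRep.indAlg X π.φ) (flat x) (create π.φ y h)) =
          create (ModuleRep.indAlg X ρ.φ) (flat x) (create ρ.φ y (Hom.fst g h)) :=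
        (mapRight_create _ _ _ _).trans (congrArg _ (mapRight_create _ _ _ _))
      refine (congrArg (f ρ).fst h1).trans ((hfU ρ _ _ _).trans ?_)
      refine Eq.trans ?_ (congrArg (Hom.fst g) (hfU π _ _ _)).symm
      exact (Hom.fst_φ g _ _).symm
    exact congrArg (fun S => S k) this
  exact congrArg (fun S => S t) h

/-- `Ind_X̃ ∘ Ind_X` is naturally unitarily equivalent to the identity. -/
theorem exists_natIso_ind_dual (hV : IsFull A V) (hW : IsFull B W)
    (X : ImprimitivityBimodule A B) :
    ∃ α : (ind hV X : NondegRep B W ⥤ NondegRep A V) ⋙ ind hW X.dual ≅ 𝟭 (NondegRep B W),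
      ∀ π, IsUnitary (α.hom.app π) :=
  exists_natIso_ind_ind hV hW X X.dual X.toConj (fun x => ⟨X.ofConj x, rfl⟩)
    (fun _ _ => rfl) fun _ _ => rfl

/-- `Ind_X ∘ Ind_X̃` is naturally unitarily equivalent to the identity. -/
theorem exists_natIso_dual_ind (hV : IsFull A V) (hW : IsFull B W)
    (X : ImprimitivityBimodule A B) :
    ∃ β : (ind hW X.dual : NondegRep A V ⥤ NondegRep B W) ⋙ ind hV X ≅ 𝟭 (NondegRep A V),
      ∀ π, IsUnitary (β.hom.app π) :=
  -- Here `X` plays the role of the dual of `X̃`. The only discrepancy is the double adjoint in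
  -- `♭(x) a⋆ = ♭(a⋆⋆ x)`.
  exists_natIso_ind_ind hW hV X.dual X X.ofConj (fun x => ⟨X.toConj x, rfl⟩)
    (fun _ _ => rfl) fun a x => by
      change X.lsmul a (X.ofConj x) = X.lsmul (star (star a)) (X.ofConj x)
      rw [star_star]

end Induced

end NondegRep

/-! ### Rank-one operators in the algebra of compact operators -/

namespace HilbertModule

variable {A V : Type*} [NonUnitalCStarAlgebra A] [PartialOrder A] [StarOrderedRing A]
  [NormedAddCommGroup V] [NormedSpace ℂ V] [HilbertModule A V]

/-- The rank-one operator `θ_{v,w}` as a compact operator. -/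
noncomputable def compactRankOne (v w : V) : CompactOperators A V :=
  ⟨rankOne v w, (finiteRank A V).le_topologicalClosure (Submodule.subset_span ⟨v, w, rfl⟩)⟩

theorem compactRankOne_apply (v w z : V) :
    (compactRankOne v w : CompactOperators A V).1.1 z = rsmul v (ip w z : A) := rfl

theorem compactOperators_ext {S T : CompactOperators A V} (h : ∀ z : V, S.1.1 z = T.1.1 z) :
    S = T :=
  Subtype.ext (Subtype.ext (ContinuousLinearMap.ext h))

theorem star_compactRankOne (v w : V) :
    star (compactRankOne v w : CompactOperators A V) = compactRankOne w v :=
  Subtype.ext (star_rankOne v w)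

theorem mul_compactRankOne (T : CompactOperators A V) (v w : V) :
    T * compactRankOne v w = compactRankOne (T.1.1 v) w :=
  Subtype.ext (mul_rankOne T.1 v w)

theorem compactRankOne_mul (T : CompactOperators A V) (v w : V) :
    compactRankOne v w * T = compactRankOne v ((star T).1.1 w) := by
  rw [← star_star (compactRankOne v w * T), star_mul, star_compactRankOne, mul_compactRankOne,
    star_compactRankOne]

/-- The order on `K(V)` is the spectral one, so positivity of the form `⟨z, θ_{v,v} z⟩` has to be
converted into positivity in the algebra. With `N` the negative part of `M = θ_{v,v}` and `N = S⋆
S`, the operator `-(S N)⋆ (S N) = N M N = θ_{N v, N v}` has a positive form, which forces `S N = 0`,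
and then `M` has the form `R⋆ R`. -/
theorem compactRankOne_self_nonneg (v : V) : (0 : CompactOperators A V) ≤ compactRankOne v v := by
  obtain ⟨N, S, hN, h1, h2⟩ := exists_negPart_aux (compactRankOne v v : CompactOperators A V)
    (star_compactRankOne v v)
  have h3 : S * N = 0 := compactOperators_ext (A := A) fun z => by
    -- `⟨S N z, S N z⟩ = -⟨N v, z⟩⋆ ⟨N v, z⟩` is at once non-negative and non-positive.
    refine ip_self_eq_zero (A := A) _ (le_antisymm ?_ (ip_self_nonneg _))
    have h4 : (ip ((S * N).1.1 z) ((S * N).1.1 z) : A) =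
        ip z ((star (S * N) * (S * N)).1.1 z) := ip_apply_left (S * N).1 z _
    have h5 : star (S * N) * (S * N) = -(compactRankOne (N.1.1 v) (N.1.1 v) : CompactOperators A V) := by
      rw [← neg_eq_iff_eq_neg, ← h1, mul_compactRankOne, compactRankOne_mul, hN]
    have h6 : (-(compactRankOne (N.1.1 v) (N.1.1 v) : CompactOperators A V)).1.1 z =
        (-1 : ℂ) • rsmul (N.1.1 v) (ip (N.1.1 v) z : A) := by
      rw [neg_one_smul]; rfl
    rw [h4, h5, h6, ip_smul_right, ip_rsmul_right, neg_one_smul, ← star_ip (N.1.1 v) z]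
    exact neg_nonpos.mpr (star_mul_self_nonneg _)
  obtain ⟨R, hR⟩ := h2 h3
  rw [hR]
  exact star_mul_self_nonneg R

/-- Applying `θ_{v,v}` to `v` gives `v ⟨v, v⟩ = 0`, hence `⟨v, v⟩⋆ ⟨v, v⟩ = ⟨v, v ⟨v, v⟩⟩ = 0`. -/
theorem eq_zero_of_compactRankOne {v : V} (h : (compactRankOne v v : CompactOperators A V) = 0) :
    v = 0 := by
  refine ip_self_eq_zero (A := A) _ ?_
  have h1 : rsmul v (ip v v : A) = 0 := by
    rw [← compactRankOne_apply, h]; rfl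
  rw [← CStarRing.star_mul_self_eq_zero_iff, star_ip, ← ip_rsmul_right, h1, ip_zero_right]

theorem dense_span_compactRankOne :
    Dense (Submodule.span ℂ
      {T : CompactOperators A V | ∃ v w : V, compactRankOne v w = T} :
        Set (CompactOperators A V)) := by
  rw [Subtype.dense_iff]
  intro T hT
  refine closure_mono ?_ hT
  intro T hT
  induction hT using Submodule.span_induction with
  | mem T h =>
    obtain ⟨v, w, rfl⟩ := h
    exact ⟨compactRankOne v w, Submodule.subset_span ⟨v, w, rfl⟩, rfl⟩
  | zero => exact ⟨0, Submodule.zero_mem _, rfl⟩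
  | add S T _ _ hS hT =>
    obtain ⟨S, hS, rfl⟩ := hS
    obtain ⟨T, hT, rfl⟩ := hT
    exact ⟨S + T, Submodule.add_mem _ hS hT, rfl⟩
  | smul c T _ hT =>
    obtain ⟨T, hT, rfl⟩ := hT
    exact ⟨_, Submodule.smul_mem _ c hT, rfl⟩

end HilbertModule

/-! ### A full Hilbert module as an imprimitivity bimodule -/

section MoritaEquivalence

open HilbertModule

/-- A full Hilbert `A`-module `V` as a `K(V)`–`A`-imprimitivity bimodule. -/
noncomputable def ImprimitivityBimodule.ofFull {A V : Type u} [NonUnitalCStarAlgebra A]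
    [PartialOrder A] [StarOrderedRing A] [NormedAddCommGroup V] [NormedSpace ℂ V]
    [HilbertModule A V] (hV : IsFull A V) : ImprimitivityBimodule (CompactOperators A V) A where
  carrier := V
  lsmul T v := T.1.1 v
  add_lsmul _ _ _ := rfl
  lsmul_add T v w := map_add T.1.1 v w
  mul_lsmul _ _ _ := rfl
  smul_lsmul _ _ _ := rfl
  lsmul_smul c T v := map_smul T.1.1 c v
  -- Membership in `L(V)` asks only for an adjoint; `A`-linearity follows from its existence.
  lsmul_rsmul T v a := ext_ip A fun z => by
    rw [ip_apply_right, ip_rsmul_right, ip_rsmul_right, ip_apply_right]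
  lip v w := compactRankOne v w
  lip_add_left v v' w := compactOperators_ext fun z => add_rsmul v v' _
  lip_smul_left c v w := compactOperators_ext fun z => smul_rsmul c v _
  lip_lsmul_left T v w := (mul_compactRankOne T v w).symm
  star_lip := star_compactRankOne
  lip_self_nonneg := compactRankOne_self_nonneg
  lip_self_eq_zero _ := eq_zero_of_compactRankOne
  full_left := dense_span_compactRankOne
  full_right := hV
  ip_lsmul_left T v w := ip_apply_left T.1 v w
  lip_rsmul_left v w a := compactOperators_ext (A := A) fun z => by
    rw [compactRankOne_apply, compactRankOne_apply, ip_rsmul_left, star_star, rsmul_mul]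
  lip_lsmul _ _ _ := rfl

/-! ### Unitary equivalences between categories of representations -/

namespace NondegRep

open CategoryTheory

variable {A B C V W Z : Type u} [NonUnitalCStarAlgebra A] [PartialOrder A]
  [NonUnitalCStarAlgebra B] [PartialOrder B] [NonUnitalCStarAlgebra C] [PartialOrder C]
  [NormedAddCommGroup V] [NormedSpace ℂ V] [HilbertModule A V]
  [NormedAddCommGroup W] [NormedSpace ℂ W] [HilbertModule B W]
  [NormedAddCommGroup Z] [NormedSpace ℂ Z] [HilbertModule C Z]

/-- An equivalence of categories of non-degenerate representations is unitary if its functors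
preserve unitary morphisms and its unit and counit are unitary. -/
structure IsUnitaryEquivalence (e : NondegRep A V ≌ NondegRep B W) : Prop where
  functor : ∀ (π ρ : NondegRep A V) (f : π ⟶ ρ), IsUnitary f → IsUnitary (e.functor.map f)
  inverse : ∀ (π ρ : NondegRep B W) (f : π ⟶ ρ), IsUnitary f → IsUnitary (e.inverse.map f)
  unit : ∀ π, IsUnitary (e.unit.app π)
  counit : ∀ π, IsUnitary (e.counit.app π)

theorem IsUnitaryEquivalence.symm {e : NondegRep A V ≌ NondegRep B W}
    (he : IsUnitaryEquivalence e) : IsUnitaryEquivalence e.symm where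
  functor := he.inverse
  inverse := he.functor
  unit π := isUnitary_inv (he.counit π) (e.counitIso.hom_inv_id_app π)
  counit π := isUnitary_inv (he.unit π) (e.unitIso.hom_inv_id_app π)

/-- The unit and counit of a composite contain images of the given ones under `e.inverse` and
`e'.functor`; this is where preservation of unitary morphisms is needed. -/
theorem IsUnitaryEquivalence.trans {e : NondegRep A V ≌ NondegRep B W}
    {e' : NondegRep B W ≌ NondegRep C Z} (he : IsUnitaryEquivalence e)
    (he' : IsUnitaryEquivalence e') : IsUnitaryEquivalence (e.trans e') where
  functor _ _ f hf := he'.functor _ _ _ (he.functor _ _ f hf)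
  inverse _ _ f hf := he.inverse _ _ _ (he'.inverse _ _ f hf)
  unit π := by
    have h : (e.trans e').unit.app π =
        e.unit.app π ≫ e.inverse.map (e'.unit.app (e.functor.obj π)) := by
      simp [Equivalence.unit]
      rfl
    rw [h]
    exact isUnitary_comp (he.unit π) (he.inverse _ _ _ (he'.unit _))
  counit π := by
    have h : (e.trans e').counit.app π =
        e'.functor.map (e.counit.app (e'.inverse.obj π)) ≫ e'.counit.app π := by
      simp [Equivalence.counit]
      rfl
    rw [h]
    exact isUnitary_comp (he'.functor _ _ _ (he.counit _)) (he'.counit π)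

variable [StarOrderedRing A] [StarOrderedRing B]

/-- Rieffel induction is a unitary equivalence of categories. -/
theorem exists_isUnitaryEquivalence (hV : IsFull A V) (hW : IsFull B W)
    (X : ImprimitivityBimodule A B) :
    ∃ e : NondegRep B W ≌ NondegRep A V, IsUnitaryEquivalence e := by
  obtain ⟨α, hα⟩ := exists_natIso_ind_dual hV hW X
  obtain ⟨β, hβ⟩ := exists_natIso_dual_ind hV hW X
  have hα' : ∀ π, IsUnitary (α.inv.app π) := fun π =>
    isUnitary_inv (hα π) (α.hom_inv_id_app π)
  have hβ' : ∀ π, IsUnitary (β.inv.app π) := fun π =>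
    isUnitary_inv (hβ π) (β.hom_inv_id_app π)
  refine ⟨CategoryTheory.Equivalence.mk (ind hV X) (ind hW X.dual) α.symm β,
    fun _ _ _ => isUnitary_ind_map hV X, fun _ _ _ => isUnitary_ind_map hW X.dual,
    fun π => ?_, hβ⟩
  -- `Equivalence.mk` keeps the counit `β` but modifies the unit to enforce the triangle identities.
  -- The modified unit is a composite of `α⁻¹` with induced images of `β⁻¹` and `α`, all unitary.
  have h : (Equivalence.adjointifyη α.symm β).hom.app π =
      α.inv.app π ≫ (ind hW X.dual).map (β.inv.app ((ind hV X).obj π)) ≫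
        (ind hW X.dual).map ((ind hV X).map (α.hom.app π)) := by
    simp [Equivalence.adjointifyη, Trans.trans]
  change IsUnitary ((Equivalence.adjointifyη α.symm β).hom.app π)
  rw [h]
  exact isUnitary_comp (hα' _) (isUnitary_comp (isUnitary_ind_map hW X.dual (hβ' _))
    (isUnitary_ind_map hW X.dual (isUnitary_ind_map hV X (hα _))))

end NondegRep

end MoritaEquivalence

/-! ### Proof of the theorem -/

open CategoryTheory in
theorem mainTheorem1 {A B V W : Type u}
    [NonUnitalCStarAlgebra A] [PartialOrder A] [StarOrderedRing A]
    [NonUnitalCStarAlgebra B] [PartialOrder B] [StarOrderedRing B]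
    [NormedAddCommGroup V] [NormedSpace ℂ V] [HilbertModule A V]
    [NormedAddCommGroup W] [NormedSpace ℂ W] [HilbertModule B W]
    (hV : IsFull A V) (hW : IsFull B W) :
    (∀ X : ImprimitivityBimodule A B,
      (∃ α : (NondegRep.ind hV X : NondegRep B W ⥤ NondegRep A V) ⋙ NondegRep.ind hW X.dual ≅
          𝟭 (NondegRep B W),
        ∀ Φ : NondegRep B W, NondegRep.IsUnitary (α.hom.app Φ)) ∧
      (∃ β : (NondegRep.ind hW X.dual : NondegRep A V ⥤ NondegRep B W) ⋙ NondegRep.ind hV X ≅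
          𝟭 (NondegRep A V),
        ∀ Ψ : NondegRep A V, NondegRep.IsUnitary (β.hom.app Ψ))) ∧
    (HilbertModule.MoritaEquivalent A V B W →
      ∃ e : NondegRep B W ≌ NondegRep A V,
        (∀ (Φ Φ' : NondegRep B W) (f : Φ ⟶ Φ'),
          NondegRep.IsUnitary f → NondegRep.IsUnitary (e.functor.map f)) ∧
        (∀ (Ψ Ψ' : NondegRep A V) (g : Ψ ⟶ Ψ'),
          NondegRep.IsUnitary g → NondegRep.IsUnitary (e.inverse.map g)) ∧
        (∀ Φ : NondegRep B W, NondegRep.IsUnitary (e.unit.app Φ)) ∧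
        (∀ Ψ : NondegRep A V, NondegRep.IsUnitary (e.counit.app Ψ))) := by
  refine ⟨fun X => ⟨NondegRep.exists_natIso_ind_dual hV hW X,
    NondegRep.exists_natIso_dual_ind hV hW X⟩, fun ⟨X⟩ => ?_⟩
  let XV := ImprimitivityBimodule.ofFull hV
  let XW := ImprimitivityBimodule.ofFull hW
  -- Induction links representations of modules, so full Hilbert modules over `K(W)` and `K(V)` are
  -- needed as intermediate stages. The conjugate modules `W̃` and `Ṽ` serve, their fullness being
  -- part of the dual bimodules. The chain runs from `W` to `W̃` along `XW`, to `Ṽ` along `X`, and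
  -- back to `V` by inverting the equivalence given by `XV`.
  obtain ⟨e₁, h₁⟩ := NondegRep.exists_isUnitaryEquivalence XW.dual.full_right hW XW
  obtain ⟨e₂, h₂⟩ := NondegRep.exists_isUnitaryEquivalence XV.dual.full_right XW.dual.full_right X
  obtain ⟨e₃, h₃⟩ := NondegRep.exists_isUnitaryEquivalence XV.dual.full_right hV XV
  have h := (h₁.trans h₂).trans h₃.symm
  exact ⟨_, h.functor, h.inverse, h.unit, h.counit⟩
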